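/- Let $A>0$, $\gamma>1$, $p(\rho)=A\rho^\gamma$, $c(\rho)=\sqrt{\gamma A}\,\rho^{(\gamma-1)/2}$, $\rho e=p/(\gamma-1)$. Consider a one-dimensional isentropic gas flow $(\rho,u)(x,t)$ defined for all $t\in\mathbb R$ and surrounded by vacuum, which at each time $t$ occupies a bounded nonempty interval $\Omega(t)=(a(t),b(t))$; put $\Omega=\{(x,t): a(t)<x<b(t)\}$. Assume that the flow is admissible, that is: 1. $\rho\ge 0$ and $u$ are measurable, bounded on $\Omega$, and $\rho>0$ exactly on $\Omega$; the functions $b$ and $-a$ are convex. 2. In the sense of distributions in $\Omega$, $\partial_t\rho+\partial_x(\rho u)=0$, $\partial_t(\rho u)+\partial_x(\rho u^2+p(\rho))=0$ and $\partial_t\left(\tfrac12\rho u^2+\rho e\right)+\partial_x\left(\left(\tfrac12\rho u^2+\rho e+p\right)u\right)\le 0$. 3. For almost every boundary point $P\in\partial\Omega$, $\rho(x,t)\to0$ as $(x,t)\to P$ in $\Omega$. 4. Call an integral curve in $\Omega$ of $dX/dt=u-c$ (respectively $dX/dt=u+c$) a $1$-characteristic (respectively a $2$-characteristic). A $2$-characteristic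 can reach the right boundary $x=b(t)$ only at its terminal point and the left boundary $x=a(t)$ only at its initial point; a $1$-characteristic can reach the right boundary only at its initial point and the left boundary only at its terminal point. Assume moreover that the flow is shock-free, in the sense that $\rho$ and $u$ are smooth (of class $C^2$) in $\Omega$. Then the boundary velocities $a'$ and $b'$ (defined for all but countably many $t$) have finite limits $p_\pm=\lim_{t\to\pm\infty}a'(t)$ and $q_\pm=\lim_{t\to\pm\infty}b'(t)$, and $$p_+=q_-\qquad\text{and}\qquad p_-=q_+ .$$ -/

import Mathlib

open Set Filter Topology MeasureTheory
open scoped ContDiff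

noncomputable section

namespace GasFlow

/-- The space-time domain occupied by the gas. Points of the plane are written `z = (x, t)`;
at time `t` the gas occupies the open interval `(a t, b t)`. -/
def domain (a b : ℝ → ℝ) : Set (ℝ × ℝ) := {z | a z.2 < z.1 ∧ z.1 < b z.2}

/-- The polytropic pressure law `p = A ρ ^ γ`. -/
def pressure (A γ r : ℝ) : ℝ := A * r ^ γ

/-- The sound speed `c = √(p'(ρ)) = √(γ A) ρ ^ κ`, with `κ = (γ - 1) / 2`. -/
def soundSpeed (A γ r : ℝ) : ℝ := √(γ * A) * r ^ ((γ - 1) / 2)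

/-- The mechanical energy `ρ u² / 2 + ρ e`, where `ρ e = p / (γ - 1)`. -/
def energy (A γ r v : ℝ) : ℝ := r * v ^ 2 / 2 + pressure A γ r / (γ - 1)

/-- The pairing `∫∫ (g ∂ₜφ + f ∂ₓφ) dx dt`, that is `-⟨∂ₜg + ∂ₓf, φ⟩`. -/
def weakPairing (g f φ : ℝ × ℝ → ℝ) : ℝ :=
  ∫ z : ℝ × ℝ, (g z * fderiv ℝ φ z (0, 1) + f z * fderiv ℝ φ z (1, 0))

/-- Test functions on the set `U`. -/
def IsTestFunction (U : Set (ℝ × ℝ)) (φ : ℝ × ℝ → ℝ) : Prop :=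
  ContDiff ℝ ∞ φ ∧ HasCompactSupport φ ∧ tsupport φ ⊆ U

/-- `∂ₜ g + ∂ₓ f = 0` in `U`, in the sense of distributions. -/
def ConservedIn (U : Set (ℝ × ℝ)) (g f : ℝ × ℝ → ℝ) : Prop :=
  ∀ φ : ℝ × ℝ → ℝ, IsTestFunction U φ → weakPairing g f φ = 0

/-- `∂ₜ g + ∂ₓ f ≤ 0` in `U`, in the sense of distributions. -/
def DissipatedIn (U : Set (ℝ × ℝ)) (g f : ℝ × ℝ → ℝ) : Prop :=
  ∀ φ : ℝ × ℝ → ℝ, IsTestFunction U φ → (∀ z, 0 ≤ φ z) → 0 ≤ weakPairing g f φ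

/-- `X` is, over the time interval `I`, a characteristic curve of velocity field `w` in `U`:
an integral curve of `dX/dt = w (X, t)` inside `U`, together with those of its end points
(limits of the curve) whose times belong to `I`; these may lie on the boundary of `U`. -/
structure IsCharacteristic (U : Set (ℝ × ℝ)) (w : ℝ × ℝ → ℝ) (I : Set ℝ) (X : ℝ → ℝ) :
    Prop where
  interval : I.OrdConnected
  continuousOn : ContinuousOn X I
  mem : ∀ t ∈ interior I, (X t, t) ∈ U
  hasDerivAt : ∀ t ∈ interior I, HasDerivAt X (w (X t, t)) t

/-- An eternal (defined for all times) admissible one-dimensional isentropic flow with density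
`ρ` and velocity `u`, surrounded by vacuum; `a` and `b` are the left and right boundary curves. -/
structure IsAdmissible (A γ : ℝ) (a b : ℝ → ℝ) (ρ u : ℝ × ℝ → ℝ) : Prop where
  measurable_density : Measurable ρ
  measurable_velocity : Measurable u
  density_nonneg : ∀ z, 0 ≤ ρ z
  bounded : ∃ M : ℝ, ∀ z ∈ domain a b, ρ z ≤ M ∧ |u z| ≤ M
  /-- The gas occupies a nonempty interval at each time. -/
  nonempty : ∀ t, a t < b t
  /-- The domain is exactly the region where there is gas. -/
  density_pos_iff : ∀ z, 0 < ρ z ↔ z ∈ domain a b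
  convex_right : ConvexOn ℝ univ b
  convex_left : ConvexOn ℝ univ (fun t => -a t)
  /-- Conservation of mass. -/
  mass : ConservedIn (domain a b) ρ (fun z => ρ z * u z)
  /-- Conservation of momentum. -/
  momentum : ConservedIn (domain a b) (fun z => ρ z * u z)
    (fun z => ρ z * u z ^ 2 + pressure A γ (ρ z))
  /-- The energy inequality. -/
  energy_ineq : DissipatedIn (domain a b) (fun z => energy A γ (ρ z) (u z))
    (fun z => (energy A γ (ρ z) (u z) + pressure A γ (ρ z)) * u z)
  /-- The density vanishes at almost every point of the right boundary. Since `b` is locally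
  Lipschitz, arc length and the time parameter give the same null sets. -/
  vacuum_right : ∀ᵐ t : ℝ, Tendsto ρ (𝓝[domain a b] (b t, t)) (𝓝 0)
  /-- The density vanishes at almost every point of the left boundary. -/
  vacuum_left : ∀ᵐ t : ℝ, Tendsto ρ (𝓝[domain a b] (a t, t)) (𝓝 0)
  /-- A 2-characteristic that reaches the right boundary ends there. -/
  char_two_right : ∀ (I : Set ℝ) (X : ℝ → ℝ),
    IsCharacteristic (domain a b) (fun z => u z + soundSpeed A γ (ρ z)) I X →
      ∀ t ∈ I, X t = b t → IsGreatest I t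
  /-- A 2-characteristic that reaches the left boundary starts there. -/
  char_two_left : ∀ (I : Set ℝ) (X : ℝ → ℝ),
    IsCharacteristic (domain a b) (fun z => u z + soundSpeed A γ (ρ z)) I X →
      ∀ t ∈ I, X t = a t → IsLeast I t
  /-- A 1-characteristic that reaches the right boundary starts there. -/
  char_one_right : ∀ (I : Set ℝ) (X : ℝ → ℝ),
    IsCharacteristic (domain a b) (fun z => u z - soundSpeed A γ (ρ z)) I X →
      ∀ t ∈ I, X t = b t → IsLeast I t
  /-- A 1-characteristic that reaches the left boundary ends there. -/
  char_one_left : ∀ (I : Set ℝ) (X : ℝ → ℝ),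
    IsCharacteristic (domain a b) (fun z => u z - soundSpeed A γ (ρ z)) I X →
      ∀ t ∈ I, X t = a t → IsGreatest I t

/-- `f'(t) → v` along the filter `l`, where `t` runs over the points at which `f` is
differentiable (and such points exist arbitrarily far along `l`). -/
def DerivTendsto (f : ℝ → ℝ) (l : Filter ℝ) (v : ℝ) : Prop :=
  (l ⊓ 𝓟 {t | DifferentiableAt ℝ f t}).NeBot ∧
    Tendsto (deriv f) (l ⊓ 𝓟 {t | DifferentiableAt ℝ f t}) (𝓝 v)

end GasFlow

end

/-!
The motion is studied through its characteristics. With `κ = (γ - 1) / 2` and `c` the sound speed,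
`u + c / κ` is constant along 2-characteristics (speed `u + c`) and `u - c / κ` along
1-characteristics (speed `u - c`). At almost every boundary point `c` tends to zero, and both
invariants are compared there with the velocity of the boundary, because otherwise some
characteristic would cross the boundary in the forbidden sense (`Flow.eventually_deriv_sub_le`,
`Flow.eventually_le_deriv_add`). This also bounds `a'` and `b'`, which are monotone; their limits
are their suprema and infima.

The heart of the matter is that every upper bound `p` of `a'` is an upper bound of `b'`
(`Flow.deriv_right_le`). Suppose that `b'` exceeds `q > p` somewhere. Then `u + c / κ > q` near some
point of the right boundary. The 2-characteristics through the points where `u + c / κ > q` are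
followed backwards in time.

* They do not come from `t = -∞` (`Flow.riemann_le_of_eternal`). The mass to the left of such a
  characteristic is finite and is not lost through the left boundary, where the density vanishes
  almost everywhere (`Flow.mass_balance`). So the flux `ρ c` through the characteristic is
  integrable, `c` is negligible on average, and the characteristic would have mean speed larger
  than `p` and leave the domain through `a` in the far past.
* Hence they come from the left boundary, and they all come from one and the same point of it
  (`Flow.emission_time_eq`), because at almost every time the left boundary emits characteristics
  with `u + c / κ ≤ p`.
* A fan that issues from one boundary point cannot fill the domain shortly after its emission,
  because speeds are bounded. So `u + c / κ` falls back to `q` to the right of it, and is strictly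
  decreasing in some part of the fan. This is impossible (`Flow.not_compressive_fan`). In the left
  half of that part `c` is bounded below (`Flow.riemann_one_lt`), and the integral of
  `c ^ ((1 - κ) / (2 κ))` between two characteristics, which vanishes at the emission time, does not
  increase (`Flow.sound_power_law`). This is an integrated form of Lax's Riccati argument.

The reflections `(x, t) ↦ (-x, t)` and `(x, t) ↦ (-x, -t)` map smooth flows to smooth flows
(`Flow.reflect`). Applied to them, the same statement shows that `a'` and `b'` have the same upper
bounds and the same lower bounds (`Flow.bounds_slopes`). As `a` is concave and `b` convex, the
supremum is the limit of `a'` at `-∞` and of `b'` at `+∞`, and the infimum is the limit of `a'` at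
`+∞` and of `b'` at `-∞`.
-/

noncomputable section

namespace GasFlow

/-! ### Smooth flows in terms of velocity and sound speed -/

/-- A shock-free eternal flow, reduced to the properties that survive the reflections
`(x, t) ↦ (-x, ± t)`. The sound speed `c` is an unknown of its own, so that the Riemann invariants
`u ± c / κ` are linear in the unknowns, and the equations hold pointwise. Of the state law
`c = c(ρ)` only `compare` is kept. -/
structure Flow (κ : ℝ) (a b : ℝ → ℝ) (ρ u c : ℝ × ℝ → ℝ) : Prop where
  kappa_pos : 0 < κ
  measurable_density : Measurable ρ
  bounded : ∃ M : ℝ, ∀ z ∈ domain a b, ρ z ≤ M ∧ |u z| ≤ M ∧ c z ≤ M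
  density_pos : ∀ z ∈ domain a b, 0 < ρ z
  sound_pos : ∀ z ∈ domain a b, 0 < c z
  /-- The sound speed is small where the gas is thin. -/
  compare : ∀ ε > 0, ∃ δ > 0, ∀ z ∈ domain a b, ε < c z → δ ≤ ρ z
  nonempty : ∀ t, a t < b t
  convex_right : ConvexOn ℝ univ b
  convex_left : ConvexOn ℝ univ (fun t => -a t)
  smooth_density : ContDiffOn ℝ 1 ρ (domain a b)
  smooth_velocity : ContDiffOn ℝ 1 u (domain a b)
  smooth_sound : ContDiffOn ℝ 1 c (domain a b)
  mass : ∀ z ∈ domain a b, fderiv ℝ ρ z (0, 1) + u z * fderiv ℝ ρ z (1, 0)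
    + ρ z * fderiv ℝ u z (1, 0) = 0
  eq_velocity : ∀ z ∈ domain a b, fderiv ℝ u z (0, 1) + u z * fderiv ℝ u z (1, 0)
    + c z / κ * fderiv ℝ c z (1, 0) = 0
  eq_sound : ∀ z ∈ domain a b, fderiv ℝ c z (0, 1) + u z * fderiv ℝ c z (1, 0)
    + κ * c z * fderiv ℝ u z (1, 0) = 0
  vacuum_right : ∀ᵐ t : ℝ, Tendsto ρ (𝓝[domain a b] (b t, t)) (𝓝 0) ∧
    Tendsto c (𝓝[domain a b] (b t, t)) (𝓝 0)
  vacuum_left : ∀ᵐ t : ℝ, Tendsto ρ (𝓝[domain a b] (a t, t)) (𝓝 0) ∧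
    Tendsto c (𝓝[domain a b] (a t, t)) (𝓝 0)
  char_two_right : ∀ (I : Set ℝ) (X : ℝ → ℝ),
    IsCharacteristic (domain a b) (fun z => u z + c z) I X →
      ∀ t ∈ I, X t = b t → IsGreatest I t
  char_two_left : ∀ (I : Set ℝ) (X : ℝ → ℝ),
    IsCharacteristic (domain a b) (fun z => u z + c z) I X →
      ∀ t ∈ I, X t = a t → IsLeast I t
  char_one_right : ∀ (I : Set ℝ) (X : ℝ → ℝ),
    IsCharacteristic (domain a b) (fun z => u z - c z) I X →
      ∀ t ∈ I, X t = b t → IsLeast I t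
  char_one_left : ∀ (I : Set ℝ) (X : ℝ → ℝ),
    IsCharacteristic (domain a b) (fun z => u z - c z) I X →
      ∀ t ∈ I, X t = a t → IsGreatest I t

/-- The reflection `(x, t) ↦ (-x, σ t)`, where `σ = ± 1`. -/
def refl (σ : ℝ) : ℝ × ℝ →L[ℝ] ℝ × ℝ :=
  (-ContinuousLinearMap.fst ℝ ℝ ℝ).prod (σ • ContinuousLinearMap.snd ℝ ℝ ℝ)

@[simp] lemma refl_apply (σ : ℝ) (z : ℝ × ℝ) : refl σ z = (-z.1, σ * z.2) := rfl

lemma mem_domain {a b : ℝ → ℝ} {x t : ℝ} : (x, t) ∈ domain a b ↔ a t < x ∧ x < b t := Iff.rfl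

lemma isOpen_domain {a b : ℝ → ℝ} (ha : Continuous a) (hb : Continuous b) :
    IsOpen (domain a b) :=
  (isOpen_lt (ha.comp continuous_snd) continuous_fst).inter
    (isOpen_lt continuous_fst (hb.comp continuous_snd))

lemma mem_domain_refl {a b : ℝ → ℝ} {σ : ℝ} (z : ℝ × ℝ) :
    z ∈ domain (fun t => -b (σ * t)) (fun t => -a (σ * t)) ↔ refl σ z ∈ domain a b := by
  simp only [domain, mem_ofPred_eq, refl_apply]
  constructor <;> rintro ⟨h₁, h₂⟩ <;> constructor <;> linarith

lemma refl_refl {σ : ℝ} (hσ : σ * σ = 1) (z : ℝ × ℝ) : refl σ (refl σ z) = z := by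
  ext <;> simp [← mul_assoc, hσ]

lemma IsCharacteristic.refl {a b : ℝ → ℝ} {σ : ℝ} (hσ : σ * σ = 1) {w w' : ℝ × ℝ → ℝ}
    (hw : ∀ z, w' z = -σ * w (refl σ z)) {I : Set ℝ} {X : ℝ → ℝ}
    (h : IsCharacteristic (domain (fun t => -b (σ * t)) (fun t => -a (σ * t))) w' I X) :
    IsCharacteristic (domain a b) w ((fun s => σ * s) ⁻¹' I) (fun s => -X (σ * s)) := by
  have hσ0 : σ ≠ 0 := by rintro rfl; simp at hσ
  have hint : interior ((fun s => σ * s) ⁻¹' I) = (fun s => σ * s) ⁻¹' interior I :=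
    ((Homeomorph.mulLeft₀ σ hσ0).preimage_interior I).symm
  have hs : ∀ s : ℝ, σ * (σ * s) = s := fun s => by rw [← mul_assoc, hσ, one_mul]
  refine ⟨?_, ?_, ?_, ?_⟩
  · rcases mul_self_eq_one_iff.1 hσ with rfl | rfl
    · simpa using h.interval
    · simp only [neg_mul, one_mul]
      exact h.interval.preimage_anti (fun x y hxy => neg_le_neg hxy)
  · exact (h.continuousOn.comp (g := X) (f := fun s => σ * s) (by fun_prop)
      (fun s hs => hs)).neg
  · intro t ht
    rw [hint] at ht
    have := (mem_domain_refl (a := a) (b := b) _).1 (h.mem _ ht)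
    simpa [hs] using this
  · intro t ht
    rw [hint] at ht
    have h1 := h.hasDerivAt _ ht
    have h2 : HasDerivAt (fun s : ℝ => σ * s) σ t := by
      simpa using (hasDerivAt_id t).const_mul σ
    have h3 := (HasDerivAt.comp t h1 h2).neg
    refine h3.congr_deriv ?_
    rw [hw]
    simp only [refl_apply, hs]
    linear_combination w (-X (σ * t), t) * hσ

lemma ae_comp_mul {σ : ℝ} (hσ : σ * σ = 1) {P : ℝ → Prop} (h : ∀ᵐ t, P t) :
    ∀ᵐ t, P (σ * t) := by
  rcases mul_self_eq_one_iff.1 hσ with rfl | rfl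
  · simpa using h
  · simpa using (Measure.measurePreserving_neg (volume : Measure ℝ)).quasiMeasurePreserving.ae h

lemma tendsto_comp_refl {a b : ℝ → ℝ} {σ : ℝ} {f : ℝ × ℝ → ℝ} {x t : ℝ}
    (h : Tendsto f (𝓝[domain a b] (x, σ * t)) (𝓝 0)) :
    Tendsto (fun z => f (refl σ z))
      (𝓝[domain (fun t => -b (σ * t)) (fun t => -a (σ * t))] (-x, t)) (𝓝 0) := by
  refine h.comp (tendsto_nhdsWithin_iff.2 ⟨?_, ?_⟩)
  · have : Tendsto (refl σ) (𝓝 (-x, t)) (𝓝 (refl σ (-x, t))) := (refl σ).continuous.tendsto _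
    rw [refl_apply, neg_neg] at this
    exact this.mono_left nhdsWithin_le_nhds
  · exact eventually_nhdsWithin_of_forall fun z hz => (mem_domain_refl z).1 hz

variable {κ : ℝ} {a b : ℝ → ℝ} {ρ u c : ℝ × ℝ → ℝ}

lemma Flow.continuous_right (h : Flow κ a b ρ u c) : Continuous b :=
  h.convex_right.locallyLipschitz.continuous

lemma Flow.continuous_left (h : Flow κ a b ρ u c) : Continuous a := by
  simpa only [neg_neg] using h.convex_left.locallyLipschitz.continuous.fun_neg

lemma Flow.isOpen (h : Flow κ a b ρ u c) : IsOpen (domain a b) :=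
  isOpen_domain h.continuous_left h.continuous_right

lemma Flow.differentiableAt (h : Flow κ a b ρ u c) {f : ℝ × ℝ → ℝ}
    (hf : ContDiffOn ℝ 1 f (domain a b)) {z : ℝ × ℝ} (hz : z ∈ domain a b) :
    DifferentiableAt ℝ f z :=
  (hf.contDiffAt (h.isOpen.mem_nhds hz)).differentiableAt one_ne_zero

lemma fderiv_comp_refl {σ : ℝ} {f : ℝ × ℝ → ℝ} {z : ℝ × ℝ} (hf : DifferentiableAt ℝ f (refl σ z))
    (k : ℝ) (v : ℝ × ℝ) :
    fderiv ℝ (fun y => k * f (refl σ y)) z v = k * fderiv ℝ f (refl σ z) (refl σ v) := by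
  have h1 : HasFDerivAt (fun y => f (refl σ y)) ((fderiv ℝ f (refl σ z)).comp (refl σ)) z :=
    hf.hasFDerivAt.comp z (refl σ).hasFDerivAt
  rw [(h1.const_mul k).fderiv]
  simp

lemma convexOn_comp_mul {f : ℝ → ℝ} (hf : ConvexOn ℝ univ f) (σ : ℝ) :
    ConvexOn ℝ univ (fun t => f (σ * t)) := by
  exact hf.comp_linearMap (σ • (LinearMap.id : ℝ →ₗ[ℝ] ℝ))

/-- Flows are mapped to flows by the reflections `(x, t) ↦ (-x, t)`, which exchanges the two
families of characteristics, and `(x, t) ↦ (-x, -t)`, which preserves each of them. Both exchange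
the two boundaries. -/
theorem Flow.reflect (h : Flow κ a b ρ u c) {σ : ℝ} (hσ : σ * σ = 1) :
    Flow κ (fun t => -b (σ * t)) (fun t => -a (σ * t)) (fun z => ρ (refl σ z))
      (fun z => -σ * u (refl σ z)) (fun z => c (refl σ z)) := by
  have hmaps : MapsTo (refl σ) (domain (fun t => -b (σ * t)) (fun t => -a (σ * t)))
      (domain a b) := fun z hz => (mem_domain_refl z).1 hz
  have habs : |σ| = 1 := by
    rcases mul_self_eq_one_iff.1 hσ with rfl | rfl <;> simp
  have hv1 : refl σ (1, 0) = -((1 : ℝ), (0 : ℝ)) := by ext <;> simp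
  have hv2 : refl σ (0, 1) = σ • ((0 : ℝ), (1 : ℝ)) := by ext <;> simp
  have hs : ∀ s : ℝ, σ * (σ * s) = s := fun s => by rw [← mul_assoc, hσ, one_mul]
  have hkey : ∀ f : ℝ × ℝ → ℝ, ContDiffOn ℝ 1 f (domain a b) →
      ContDiffOn ℝ 1 (fun z => f (refl σ z))
        (domain (fun t => -b (σ * t)) (fun t => -a (σ * t))) := fun f hf =>
    hf.comp (refl σ).contDiff.contDiffOn hmaps
  have hd : ∀ f : ℝ × ℝ → ℝ, ContDiffOn ℝ 1 f (domain a b) → ∀ z,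
      refl σ z ∈ domain a b → ∀ v, fderiv ℝ (fun y => f (refl σ y)) z v
        = fderiv ℝ f (refl σ z) (refl σ v) := fun f hf z hz v => by
    simpa using fderiv_comp_refl (h.differentiableAt hf hz) 1 v
  refine ⟨h.kappa_pos, ?_, ?_, ?_, ?_, ?_, ?_, ?_, ?_, ?_, ?_, ?_, ?_, ?_, ?_, ?_, ?_, ?_, ?_,
    ?_, ?_⟩
  · exact h.measurable_density.comp (refl σ).continuous.measurable
  · obtain ⟨M, hM⟩ := h.bounded
    refine ⟨M, fun z hz => ?_⟩
    have := hM _ (hmaps hz)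
    simpa [abs_mul, habs] using this
  · exact fun z hz => h.density_pos _ (hmaps hz)
  · exact fun z hz => h.sound_pos _ (hmaps hz)
  · intro ε hε
    obtain ⟨δ, hδ, H⟩ := h.compare ε hε
    exact ⟨δ, hδ, fun z hz => H _ (hmaps hz)⟩
  · exact fun t => neg_lt_neg (h.nonempty _)
  · exact convexOn_comp_mul h.convex_left σ
  · simpa using convexOn_comp_mul h.convex_right σ
  · exact hkey ρ h.smooth_density
  · exact contDiffOn_const.mul (hkey u h.smooth_velocity)
  · exact hkey c h.smooth_sound
  · intro z hz
    have hz' := hmaps hz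
    have e := h.mass _ hz'
    rw [hd ρ h.smooth_density z hz', hd ρ h.smooth_density z hz',
      fderiv_comp_refl (h.differentiableAt h.smooth_velocity hz'), hv1, hv2]
    simp only [map_neg, map_smul, smul_eq_mul]
    linear_combination σ * e
  · intro z hz
    have hz' := hmaps hz
    have e := h.eq_velocity _ hz'
    rw [fderiv_comp_refl (h.differentiableAt h.smooth_velocity hz'),
      fderiv_comp_refl (h.differentiableAt h.smooth_velocity hz'),
      hd c h.smooth_sound z hz', hv1, hv2]
    simp only [map_neg, map_smul, smul_eq_mul]
    linear_combination (-1) * e + (-fderiv ℝ u (refl σ z) (0, 1)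
      - u (refl σ z) * fderiv ℝ u (refl σ z) (1, 0)) * hσ
  · intro z hz
    have hz' := hmaps hz
    have e := h.eq_sound _ hz'
    rw [hd c h.smooth_sound z hz', hd c h.smooth_sound z hz',
      fderiv_comp_refl (h.differentiableAt h.smooth_velocity hz'), hv1, hv2]
    simp only [map_neg, map_smul, smul_eq_mul]
    linear_combination σ * e
  · filter_upwards [ae_comp_mul hσ h.vacuum_left] with t ht
    exact ⟨tendsto_comp_refl ht.1, tendsto_comp_refl ht.2⟩
  · filter_upwards [ae_comp_mul hσ h.vacuum_right] with t ht
    exact ⟨tendsto_comp_refl ht.1, tendsto_comp_refl ht.2⟩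
  all_goals
    intro I X hX t ht hXt
    rcases mul_self_eq_one_iff.1 hσ with rfl | rfl
  · have := h.char_one_left _ _ (hX.refl hσ (w := fun z => u z - c z) (fun z => by ring)) t
      (by simpa using ht) (by simp [hXt])
    simpa using this
  · have := h.char_two_left _ _ (hX.refl hσ (w := fun z => u z + c z) (fun z => by ring)) (-t)
      (by simpa using ht) (by simp [hXt])
    refine ⟨ht, fun s hs => ?_⟩
    have := this.2 (show -s ∈ _ by simpa using hs)
    linarith
  · have := h.char_one_right _ _ (hX.refl hσ (w := fun z => u z - c z) (fun z => by ring)) t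
      (by simpa using ht) (by simp [hXt])
    simpa using this
  · have := h.char_two_right _ _ (hX.refl hσ (w := fun z => u z + c z) (fun z => by ring)) (-t)
      (by simpa using ht) (by simp [hXt])
    refine ⟨ht, fun s hs => ?_⟩
    have := this.2 (show -s ∈ _ by simpa using hs)
    linarith
  · have := h.char_two_left _ _ (hX.refl hσ (w := fun z => u z + c z) (fun z => by ring)) t
      (by simpa using ht) (by simp [hXt])
    simpa using this
  · have := h.char_one_left _ _ (hX.refl hσ (w := fun z => u z - c z) (fun z => by ring)) (-t)
      (by simpa using ht) (by simp [hXt])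
    refine ⟨ht, fun s hs => ?_⟩
    have := this.2 (show -s ∈ _ by simpa using hs)
    linarith
  · have := h.char_two_right _ _ (hX.refl hσ (w := fun z => u z + c z) (fun z => by ring)) t
      (by simpa using ht) (by simp [hXt])
    simpa using this
  · have := h.char_one_right _ _ (hX.refl hσ (w := fun z => u z - c z) (fun z => by ring)) (-t)
      (by simpa using ht) (by simp [hXt])
    refine ⟨ht, fun s hs => ?_⟩
    have := this.2 (show -s ∈ _ by simpa using hs)
    linarith

/-! ### Integral curves of a scalar time-dependent field -/

/-- `X` is an integral curve of `dX/dt = w (X, t)` inside `U` over the times in `I`. -/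
def IsCurve (U : Set (ℝ × ℝ)) (w : ℝ × ℝ → ℝ) (I : Set ℝ) (X : ℝ → ℝ) : Prop :=
  ∀ t ∈ I, (X t, t) ∈ U ∧ HasDerivAt X (w (X t, t)) t

lemma IsCurve.mono {U : Set (ℝ × ℝ)} {w : ℝ × ℝ → ℝ} {I J : Set ℝ} {X : ℝ → ℝ}
    (h : IsCurve U w I X) (hJ : J ⊆ I) : IsCurve U w J X := fun t ht => h t (hJ ht)

lemma IsCurve.continuousOn {U : Set (ℝ × ℝ)} {w : ℝ × ℝ → ℝ} {I : Set ℝ} {X : ℝ → ℝ}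
    (h : IsCurve U w I X) : ContinuousOn X I :=
  fun t ht => (h t ht).2.continuousAt.continuousWithinAt

section Curves

variable {w : ℝ × ℝ → ℝ} {I : Set ℝ} {X Y : ℝ → ℝ}

/-- A horizontal segment between two points of the domain stays in the domain. -/
lemma segment_mem_domain {x y z t : ℝ} (hx : (x, t) ∈ domain a b) (hy : (y, t) ∈ domain a b)
    (hz : z ∈ uIcc x y) : (z, t) ∈ domain a b := by
  rw [mem_domain] at *
  rcases mem_uIcc.1 hz with h | h <;> exact ⟨by linarith, by linarith⟩

lemma hasDerivAt_slice {f : ℝ × ℝ → ℝ} {x t : ℝ} (hf : DifferentiableAt ℝ f (x, t)) :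
    HasDerivAt (fun y => f (y, t)) (fderiv ℝ f (x, t) (1, 0)) x := by
  have h : HasDerivAt (fun y : ℝ => (y, t)) ((1 : ℝ), (0 : ℝ)) x :=
    (hasDerivAt_id x).prodMk (hasDerivAt_const x t)
  exact hf.hasFDerivAt.comp_hasDerivAt x h

lemma hasDerivAt_along {f : ℝ × ℝ → ℝ} {t v : ℝ} (hf : DifferentiableAt ℝ f (X t, t))
    (hX : HasDerivAt X v t) :
    HasDerivAt (fun s => f (X s, s))
      (fderiv ℝ f (X t, t) (0, 1) + v * fderiv ℝ f (X t, t) (1, 0)) t := by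
  have h : HasDerivAt (fun s : ℝ => (X s, s)) (v, (1 : ℝ)) t := hX.prodMk (hasDerivAt_id t)
  refine (HasFDerivAt.comp_hasDerivAt (l := f) (f := fun s => (X s, s)) t hf.hasFDerivAt
    h).congr_deriv ?_
  have : ((v, 1) : ℝ × ℝ) = (0, 1) + v • (1, 0) := by ext <;> simp
  rw [this, map_add, map_smul, smul_eq_mul]

/-- Between two continuous curves in the domain the field is uniformly Lipschitz in space. -/
lemma exists_lipschitz_between (hU : IsOpen (domain a b)) (hw : ContDiffOn ℝ 1 w (domain a b))
    {s t : ℝ} (hX : ContinuousOn X (Icc s t)) (hY : ContinuousOn Y (Icc s t))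
    (hXU : ∀ τ ∈ Icc s t, (X τ, τ) ∈ domain a b) (hYU : ∀ τ ∈ Icc s t, (Y τ, τ) ∈ domain a b) :
    ∃ K : NNReal, ∀ τ ∈ Icc s t,
      LipschitzOnWith K (fun x => w (x, τ)) (uIcc (X τ) (Y τ)) := by
  have hc : ContinuousOn (fun p : ℝ × ℝ => (X p.1 + p.2 * (Y p.1 - X p.1), p.1))
      (Icc s t ×ˢ Icc (0 : ℝ) 1) := by
    have h1 : ContinuousOn (fun p : ℝ × ℝ => X p.1) (Icc s t ×ˢ Icc (0 : ℝ) 1) :=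
      hX.comp continuousOn_fst (fun p hp => hp.1)
    have h2 : ContinuousOn (fun p : ℝ × ℝ => Y p.1) (Icc s t ×ˢ Icc (0 : ℝ) 1) :=
      hY.comp continuousOn_fst (fun p hp => hp.1)
    exact (h1.add (continuousOn_snd.mul (h2.sub h1))).prodMk continuousOn_fst
  set C := (fun p : ℝ × ℝ => (X p.1 + p.2 * (Y p.1 - X p.1), p.1)) ''
      (Icc s t ×ˢ Icc (0 : ℝ) 1) with hC
  have hCc : IsCompact C := (isCompact_Icc.prod isCompact_Icc).image_of_continuousOn hc
  have hmem : ∀ τ ∈ Icc s t, ∀ x ∈ uIcc (X τ) (Y τ), (x, τ) ∈ C := by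
    intro τ hτ x hx
    rw [← segment_eq_uIcc, segment_eq_image'] at hx
    obtain ⟨θ, hθ, rfl⟩ := hx
    exact ⟨(τ, θ), ⟨hτ, hθ⟩, by simp⟩
  have hCU : C ⊆ domain a b := by
    rintro _ ⟨⟨τ, θ⟩, ⟨hτ, hθ⟩, rfl⟩
    refine segment_mem_domain (hXU τ hτ) (hYU τ hτ) ?_
    rw [← segment_eq_uIcc, segment_eq_image']
    exact ⟨θ, hθ, by simp⟩
  have hcont : ContinuousOn (fun z => fderiv ℝ w z (1, 0)) C :=
    ((hw.continuousOn_fderiv_of_isOpen hU le_rfl).mono hCU).clm_apply continuousOn_const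
  obtain ⟨K, hK⟩ := hCc.exists_bound_of_continuousOn hcont
  refine ⟨K.toNNReal, fun τ hτ => ?_⟩
  refine (convex_uIcc _ _).lipschitzOnWith_of_nnnorm_hasDerivWithin_le
    (f' := fun x => fderiv ℝ w (x, τ) (1, 0)) (fun x hx => ?_) (fun x hx => ?_)
  · exact (hasDerivAt_slice ((hw.contDiffAt (hU.mem_nhds (hCU (hmem τ hτ x hx)))).differentiableAt
      one_ne_zero)).hasDerivWithinAt
  · rw [← NNReal.coe_le_coe, coe_nnnorm]
    exact (hK _ (hmem τ hτ x hx)).trans (Real.le_coe_toNNReal K)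

theorem IsCurve.eqOn (hU : IsOpen (domain a b)) (hw : ContDiffOn ℝ 1 w (domain a b))
    (hI : I.OrdConnected) (hX : IsCurve (domain a b) w I X) (hY : IsCurve (domain a b) w I Y)
    {t : ℝ} (ht : t ∈ I) (hXY : X t = Y t) : EqOn X Y I := by
  intro τ hτ
  have hside : ∀ p q, p ∈ I → q ∈ I → ∃ K : NNReal, ∀ τ ∈ Icc p q,
      LipschitzOnWith K (fun x => w (x, τ)) (uIcc (X τ) (Y τ)) := fun p q hp hq =>
    exists_lipschitz_between hU hw (hX.continuousOn.mono (hI.out hp hq))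
      (hY.continuousOn.mono (hI.out hp hq)) (fun τ hτ => (hX τ (hI.out hp hq hτ)).1)
      (fun τ hτ => (hY τ (hI.out hp hq hτ)).1)
  rcases le_total t τ with h | h
  · obtain ⟨K, hK⟩ := hside t τ ht hτ
    have hsub := hI.out ht hτ
    exact ODE_solution_unique_of_mem_Icc_right (v := fun t x => w (x, t))
      (s := fun t => uIcc (X t) (Y t))
      (fun s hs => hK s (Ico_subset_Icc_self hs)) (hX.continuousOn.mono hsub)
      (fun s hs => (hX s (hsub (Ico_subset_Icc_self hs))).2.hasDerivWithinAt)
      (fun s _ => left_mem_uIcc) (hY.continuousOn.mono hsub)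
      (fun s hs => (hY s (hsub (Ico_subset_Icc_self hs))).2.hasDerivWithinAt)
      (fun s _ => right_mem_uIcc) hXY (right_mem_Icc.2 h)
  · obtain ⟨K, hK⟩ := hside τ t hτ ht
    have hsub := hI.out hτ ht
    exact ODE_solution_unique_of_mem_Icc_left (v := fun t x => w (x, t))
      (s := fun t => uIcc (X t) (Y t))
      (fun s hs => hK s (Ioc_subset_Icc_self hs)) (hX.continuousOn.mono hsub)
      (fun s hs => (hX s (hsub (Ioc_subset_Icc_self hs))).2.hasDerivWithinAt)
      (fun s _ => left_mem_uIcc) (hY.continuousOn.mono hsub)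
      (fun s hs => (hY s (hsub (Ioc_subset_Icc_self hs))).2.hasDerivWithinAt)
      (fun s _ => right_mem_uIcc) hXY (left_mem_Icc.2 h)

theorem IsCurve.lt (hU : IsOpen (domain a b)) (hw : ContDiffOn ℝ 1 w (domain a b))
    (hI : I.OrdConnected) (hX : IsCurve (domain a b) w I X) (hY : IsCurve (domain a b) w I Y)
    {t : ℝ} (ht : t ∈ I) (hXY : X t < Y t) {τ : ℝ} (hτ : τ ∈ I) : X τ < Y τ := by
  by_contra! hcon
  obtain ⟨s, hs, h0⟩ := hI.isPreconnected.intermediate_value₂ ht hτ hX.continuousOn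
    hY.continuousOn hXY.le hcon
  exact hXY.ne (hX.eqOn hU hw hI hY hs h0 ht)

theorem IsCurve.le (hU : IsOpen (domain a b)) (hw : ContDiffOn ℝ 1 w (domain a b))
    (hI : I.OrdConnected) (hX : IsCurve (domain a b) w I X) (hY : IsCurve (domain a b) w I Y)
    {t : ℝ} (ht : t ∈ I) (hXY : X t ≤ Y t) {τ : ℝ} (hτ : τ ∈ I) : X τ ≤ Y τ := by
  rcases hXY.lt_or_eq with h | h
  · exact (hX.lt hU hw hI hY ht h hτ).le
  · exact (hX.eqOn hU hw hI hY ht h hτ).le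

theorem exists_isCurve (hU : IsOpen (domain a b)) (hw : ContDiffOn ℝ 1 w (domain a b)) {x t : ℝ}
    (hx : (x, t) ∈ domain a b) :
    ∃ X : ℝ → ℝ, X t = x ∧ ∃ ε > 0, IsCurve (domain a b) w (Ioo (t - ε) (t + ε)) X := by
  -- The pair (position, time) solves an autonomous equation.
  have hV : ContDiffAt ℝ 1 (fun z : ℝ × ℝ => (w z, (1 : ℝ))) (x, t) :=
    (hw.contDiffAt (hU.mem_nhds hx)).prodMk contDiffAt_const
  obtain ⟨α, hα, ε, hε, hd⟩ :=
    hV.exists_forall_mem_closedBall_exists_eq_forall_mem_Ioo_hasDerivAt₀ t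
  have htI : t ∈ Ioo (t - ε) (t + ε) := ⟨by linarith, by linarith⟩
  have hfst : ∀ τ ∈ Ioo (t - ε) (t + ε), HasDerivAt (fun s => (α s).1) (w (α τ)) τ :=
    fun τ hτ => (ContinuousLinearMap.fst ℝ ℝ ℝ).hasFDerivAt.comp_hasDerivAt τ (hd τ hτ)
  have hsnd : ∀ τ ∈ Ioo (t - ε) (t + ε), HasDerivAt (fun s => (α s).2) 1 τ :=
    fun τ hτ => (ContinuousLinearMap.snd ℝ ℝ ℝ).hasFDerivAt.comp_hasDerivAt τ (hd τ hτ)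
  have htime : ∀ τ ∈ Ioo (t - ε) (t + ε), (α τ).2 = τ := by
    intro τ hτ
    have hz : ∀ s ∈ Ioo (t - ε) (t + ε), HasDerivAt (fun s => (α s).2 - s) 0 s := fun s hs => by
      simpa using (hsnd s hs).fun_sub (hasDerivAt_id' s)
    have := isOpen_Ioo.is_const_of_deriv_eq_zero isPreconnected_Ioo
      (fun s hs => (hz s hs).differentiableAt.differentiableWithinAt)
      (fun s hs => (hz s hs).deriv) hτ htI
    simp only [hα, sub_self] at this
    linarith
  have hcont : ContinuousAt α t := (hd t htI).continuousAt
  have hev : ∀ᶠ τ in 𝓝 t, α τ ∈ domain a b :=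
    hcont.eventually_mem (by rw [hα]; exact hU.mem_nhds hx)
  obtain ⟨δ, hδ, hball⟩ := Metric.eventually_nhds_iff.1 hev
  refine ⟨fun s => (α s).1, by simp [hα], min ε δ, lt_min hε hδ, fun τ hτ => ?_⟩
  have h1 : τ ∈ Ioo (t - ε) (t + ε) :=
    ⟨by linarith [hτ.1, min_le_left ε δ], by linarith [hτ.2, min_le_left ε δ]⟩
  have h2 : α τ ∈ domain a b := hball (by
    rw [Real.dist_eq, abs_lt]
    exact ⟨by linarith [hτ.1, min_le_right ε δ], by linarith [hτ.2, min_le_right ε δ]⟩)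
  have h3 : ((α τ).1, τ) = α τ := Prod.ext rfl (htime τ h1).symm
  simp only [h3]
  exact ⟨h2, hfst τ h1⟩

lemma IsCurve.abs_sub_le {M : ℝ} (hM : ∀ z ∈ domain a b, |w z| ≤ M)
    (hI : I.OrdConnected) (hX : IsCurve (domain a b) w I X) {s t : ℝ} (hs : s ∈ I) (ht : t ∈ I) :
    |X t - X s| ≤ M * |t - s| := by
  have := hI.convex.norm_image_sub_le_of_norm_hasDerivWithin_le (f := X)
    (f' := fun τ => w (X τ, τ)) (C := M) (fun τ hτ => (hX τ hτ).2.hasDerivWithinAt)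
    (fun τ hτ => hM _ (hX τ hτ).1) hs ht
  simpa [Real.norm_eq_abs] using this

/-- Two curves that agree to first order at time `e` can be spliced there. -/
lemma IsCurve.splice {U : Set (ℝ × ℝ)} {s e T : ℝ} (hwc : ContinuousAt w (Y e, e))
    (hse : s < e) (heT : e < T) (hY : IsCurve U w (Ioc s e) Y)
    (hX : IsCurve U w (Ioo e T) X) (hlim : Tendsto X (𝓝[>] e) (𝓝 (Y e))) :
    IsCurve U w (Ioo s T) (fun τ => if τ ≤ e then Y τ else X τ) := by
  set Z : ℝ → ℝ := fun τ => if τ ≤ e then Y τ else X τ with hZ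
  have hZY : ∀ τ ≤ e, Z τ = Y τ := fun τ h => if_pos h
  have hZX : ∀ τ, e < τ → Z τ = X τ := fun τ h => if_neg (not_le.2 h)
  intro τ hτ
  rcases lt_trichotomy τ e with h | rfl | h
  · have := hY τ ⟨hτ.1, h.le⟩
    rw [hZY τ h.le]
    refine ⟨this.1, this.2.congr_of_eventuallyEq ?_⟩
    filter_upwards [Iio_mem_nhds h] with r hr using hZY r (le_of_lt hr)
  · have hYe := hY τ ⟨hτ.1, le_rfl⟩
    rw [hZY τ le_rfl]
    refine ⟨hYe.1, ?_⟩
    have hZe : ∀ r ∈ Ioo τ T, HasDerivAt Z (w (X r, r)) r := fun r hr =>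
      (hX r hr).2.congr_of_eventuallyEq
        (by filter_upwards [Ioi_mem_nhds hr.1] with r' hr' using hZX r' hr')
    have hmem : Ioo τ T ∈ 𝓝[>] τ := Ioo_mem_nhdsGT heT
    have hright : HasDerivWithinAt Z (w (Y τ, τ)) (Ici τ) τ := by
      refine hasDerivWithinAt_Ici_of_tendsto_deriv (s := Ioo τ T)
        (fun r hr => (hZe r hr).differentiableAt.differentiableWithinAt) ?_ hmem ?_
      · have : Tendsto Z (𝓝[>] τ) (𝓝 (Z τ)) := by
          rw [hZY τ le_rfl]
          refine hlim.congr' ?_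
          filter_upwards [self_mem_nhdsWithin] with r hr using (hZX r hr).symm
        exact this.mono_left (nhdsWithin_mono _ Ioo_subset_Ioi_self)
      · have : Tendsto (fun r => w (X r, r)) (𝓝[>] τ) (𝓝 (w (Y τ, τ))) :=
          hwc.tendsto.comp (hlim.prodMk_nhds (tendsto_id.mono_left nhdsWithin_le_nhds))
        refine this.congr' ?_
        filter_upwards [hmem] with r hr using (hZe r hr).deriv.symm
    have hleft : HasDerivWithinAt Z (w (Y τ, τ)) (Iic τ) τ :=
      hYe.2.hasDerivWithinAt.congr (fun r hr => hZY r hr) (hZY τ le_rfl)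
    have := hleft.union hright
    rwa [Iic_union_Ici, hasDerivWithinAt_univ] at this
  · have := hX τ ⟨h, hτ.2⟩
    rw [hZX τ h]
    refine ⟨this.1, this.2.congr_of_eventuallyEq ?_⟩
    filter_upwards [Ioi_mem_nhds h] with r hr using hZX r hr

/-- A point moving with bounded speed has a limit at the lower end of its life time. -/
lemma IsCurve.exists_tendsto {U : Set (ℝ × ℝ)} {M e T : ℝ} (hM : ∀ z ∈ U, |w z| ≤ M)
    (heT : e < T) (hX : IsCurve U w (Ioo e T) X) : ∃ x, Tendsto X (𝓝[>] e) (𝓝 x) := by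
  have hL : LipschitzOnWith M.toNNReal X (Ioo e T) :=
    (convex_Ioo e T).lipschitzOnWith_of_nnnorm_hasDerivWithin_le
      (fun τ hτ => (hX τ hτ).2.hasDerivWithinAt) (fun τ hτ => by
        rw [← NNReal.coe_le_coe, coe_nnnorm]
        exact (hM _ (hX τ hτ).1).trans (Real.le_coe_toNNReal M))
  obtain ⟨g, hg, hgX⟩ := hL.extend_real
  refine ⟨g e, ((hg.continuous.tendsto e).mono_left nhdsWithin_le_nhds).congr' ?_⟩
  filter_upwards [Ioo_mem_nhdsGT heT] with r hr using (hgX hr).symm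

/-- Through each point of the domain passes an integral curve that can be followed backwards in
time either forever or until it reaches the boundary. -/
theorem exists_backward_isCurve (ha : Continuous a) (hb : Continuous b)
    (hw : ContDiffOn ℝ 1 w (domain a b)) {M : ℝ} (hM : ∀ z ∈ domain a b, |w z| ≤ M) {x t : ℝ}
    (hx : (x, t) ∈ domain a b) :
    ∃ (X : ℝ → ℝ) (T : ℝ), t < T ∧ X t = x ∧ (IsCurve (domain a b) w (Iio T) X ∨
      ∃ e < t, IsCurve (domain a b) w (Ioo e T) X ∧ ContinuousOn X (Ico e T) ∧
        (X e = a e ∨ X e = b e)) := by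
  have hU := isOpen_domain ha hb
  obtain ⟨X₀, hX₀, ε, hε, hcurve₀⟩ := exists_isCurve hU hw hx
  set T := t + ε with hT
  have htT : t < T := by linarith
  set S : Set ℝ := {s | s < t ∧ ∃ X, X t = x ∧ IsCurve (domain a b) w (Ioo s T) X} with hS
  have hS0 : t - ε ∈ S := ⟨by linarith, X₀, hX₀, hcurve₀⟩
  choose! Φ hΦ using fun s (hs : s ∈ S) => hs.2
  have hagree : ∀ s ∈ S, ∀ s' ∈ S, EqOn (Φ s) (Φ s') (Ioo (max s s') T) := by
    intro s hs s' hs'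
    refine IsCurve.eqOn hU hw ordConnected_Ioo
      ((hΦ s hs).2.mono (Ioo_subset_Ioo_left (le_max_left _ _)))
      ((hΦ s' hs').2.mono (Ioo_subset_Ioo_left (le_max_right _ _)))
      ⟨max_lt hs.1 hs'.1, htT⟩ ?_
    rw [(hΦ s hs).1, (hΦ s' hs').1]
  -- Glue the solutions that start at the times of `S`.
  classical
  set X : ℝ → ℝ := fun τ => if h : ∃ s ∈ S, s < τ then Φ h.choose τ else 0 with hXdef
  have hXeq : ∀ s ∈ S, EqOn X (Φ s) (Ioo s T) := by
    intro s hs τ hτ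
    have h : ∃ s ∈ S, s < τ := ⟨s, hs, hτ.1⟩
    have : X τ = Φ h.choose τ := dif_pos h
    rw [this]
    exact hagree _ h.choose_spec.1 s hs ⟨max_lt h.choose_spec.2 hτ.1, hτ.2⟩
  have hXt : X t = x := by
    rw [hXeq _ hS0 ⟨by linarith, htT⟩, (hΦ _ hS0).1]
  have hXc : ∀ s ∈ S, IsCurve (domain a b) w (Ioo s T) X := by
    intro s hs τ hτ
    have := (hΦ s hs).2 τ hτ
    rw [hXeq s hs hτ]
    refine ⟨this.1, this.2.congr_of_eventuallyEq ?_⟩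
    filter_upwards [Ioo_mem_nhds hτ.1 hτ.2] with r hr using hXeq s hs hr
  by_cases hbdd : BddBelow S
  swap
  · refine ⟨X, T, htT, hXt, Or.inl fun τ hτ => ?_⟩
    rw [not_bddBelow_iff] at hbdd
    obtain ⟨s, hs, hsτ⟩ := hbdd τ
    exact hXc s hs τ ⟨hsτ, hτ⟩
  set e := sInf S with he
  have het : e < t := lt_of_le_of_lt (csInf_le hbdd hS0) (by linarith)
  have hXe : IsCurve (domain a b) w (Ioo e T) X := by
    intro τ hτ
    obtain ⟨s, hs, hsτ⟩ := exists_lt_of_csInf_lt ⟨_, hS0⟩ hτ.1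
    exact hXc s hs τ ⟨hsτ, hτ.2⟩
  obtain ⟨y, hy⟩ := hXe.exists_tendsto hM (het.trans htT)
  have hle : a e ≤ y ∧ y ≤ b e := by
    constructor
    · refine le_of_tendsto_of_tendsto ((ha.tendsto e).mono_left nhdsWithin_le_nhds) hy ?_
      filter_upwards [Ioo_mem_nhdsGT (het.trans htT)] with r hr using (hXe r hr).1.1.le
    · refine le_of_tendsto_of_tendsto hy ((hb.tendsto e).mono_left nhdsWithin_le_nhds) ?_
      filter_upwards [Ioo_mem_nhdsGT (het.trans htT)] with r hr using (hXe r hr).1.2.le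
  have hbd : y = a e ∨ y = b e := by
    by_contra! hne
    have hye : (y, e) ∈ domain a b :=
      ⟨lt_of_le_of_ne hle.1 hne.1.symm, lt_of_le_of_ne hle.2 hne.2⟩
    obtain ⟨Y, hY, δ, hδ, hYc⟩ := exists_isCurve hU hw hye
    have hsp := IsCurve.splice (s := e - δ) (e := e) (T := T) (Y := Y) (X := X) (w := w)
      (by rw [hY]; exact (hw.contDiffAt (hU.mem_nhds hye)).continuousAt) (by linarith)
      (het.trans htT) (hYc.mono fun r hr => ⟨hr.1, by linarith [hr.2]⟩) hXe (by rwa [hY])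
    have : e - δ ∈ S := ⟨by linarith, _, by simp [not_le.2 het, hXt], hsp⟩
    linarith [csInf_le hbdd this]
  have hne : ∀ τ, e < τ → Function.update X e y τ = X τ := fun τ hτ =>
    Function.update_of_ne hτ.ne' _ _
  have hcurve : IsCurve (domain a b) w (Ioo e T) (Function.update X e y) := by
    intro τ hτ
    rw [hne τ hτ.1]
    refine ⟨(hXe τ hτ).1, (hXe τ hτ).2.congr_of_eventuallyEq ?_⟩
    filter_upwards [Ioi_mem_nhds hτ.1] with r hr using hne r hr
  refine ⟨Function.update X e y, T, htT, by rw [hne t het, hXt], Or.inr ⟨e, het, hcurve, ?_, ?_⟩⟩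
  · intro τ hτ
    rcases hτ.1.eq_or_lt with rfl | h
    · rw [ContinuousWithinAt, Function.update_self]
      have : Tendsto (Function.update X e y) (𝓝[≥] e) (𝓝 y) := by
        rw [← Ioi_insert, nhdsWithin_insert]
        refine tendsto_sup.2 ⟨?_, ?_⟩
        · rw [tendsto_pure_left]
          intro s hs
          simpa using mem_of_mem_nhds hs
        · refine hy.congr' ?_
          filter_upwards [self_mem_nhdsWithin] with r hr using (hne r hr).symm
      exact this.mono_left (nhdsWithin_mono _ Ico_subset_Ici_self)
    · exact (hcurve τ ⟨h, hτ.2⟩).2.continuousAt.continuousWithinAt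
  · simpa using hbd

end Curves

/-! ### Characteristics and Riemann invariants -/

lemma IsCurve.refl {σ : ℝ} (hσ : σ * σ = 1) {w w' : ℝ × ℝ → ℝ}
    (hw : ∀ z, w' z = -σ * w (refl σ z)) {I : Set ℝ} {X : ℝ → ℝ}
    (h : IsCurve (domain (fun t => -b (σ * t)) (fun t => -a (σ * t))) w' I X) :
    IsCurve (domain a b) w ((fun s => σ * s) ⁻¹' I) (fun s => -X (σ * s)) := by
  have hs : ∀ s : ℝ, σ * (σ * s) = s := fun s => by rw [← mul_assoc, hσ, one_mul]
  intro t ht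
  obtain ⟨h0, h1⟩ := h _ ht
  refine ⟨by simpa [hs] using (mem_domain_refl (a := a) (b := b) _).1 h0, ?_⟩
  have h2 : HasDerivAt (fun s : ℝ => σ * s) σ t := by
    simpa using (hasDerivAt_id t).const_mul σ
  refine (HasDerivAt.comp t h1 h2).neg.congr_deriv ?_
  rw [hw]
  simp only [refl_apply, hs]
  linear_combination w (-X (σ * t), t) * hσ

lemma IsCurve.sub_le {U : Set (ℝ × ℝ)} {w : ℝ × ℝ → ℝ} {X : ℝ → ℝ} {s t C : ℝ}
    (hX : IsCurve U w (Icc s t) X) (hst : s ≤ t) (hC : ∀ τ ∈ Icc s t, w (X τ, τ) ≤ C) :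
    X t - X s ≤ C * (t - s) :=
  (convex_Icc s t).image_sub_le_mul_sub_of_deriv_le hX.continuousOn
    (fun τ hτ => (hX τ (interior_subset hτ)).2.differentiableAt.differentiableWithinAt)
    (fun τ hτ => by
      rw [(hX τ (interior_subset hτ)).2.deriv]
      exact hC τ (interior_subset hτ)) s (left_mem_Icc.2 hst) t (right_mem_Icc.2 hst) hst

lemma Flow.smooth_two (h : Flow κ a b ρ u c) :
    ContDiffOn ℝ 1 (fun z => u z + c z) (domain a b) := h.smooth_velocity.add h.smooth_sound

lemma Flow.exists_speed_bound (h : Flow κ a b ρ u c) :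
    ∃ M > 0, ∀ z ∈ domain a b, ρ z ≤ M ∧ |u z| ≤ M ∧ c z ≤ M ∧ |u z + c z| ≤ M := by
  obtain ⟨M, hM⟩ := h.bounded
  refine ⟨2 * |M| + 1, by positivity, fun z hz => ?_⟩
  obtain ⟨h1, h2, h3⟩ := hM z hz
  have h4 := h.sound_pos z hz
  have h5 := le_abs_self M
  have h6 := abs_nonneg M
  simp only [abs_le] at h2 ⊢
  refine ⟨by linarith, ⟨by linarith, by linarith⟩, by linarith, ⟨by linarith, by linarith⟩⟩

/-- A 2-characteristic followed backwards in time lives forever or reaches the left boundary. -/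
theorem Flow.exists_backward_two (h : Flow κ a b ρ u c) {x t : ℝ} (hx : (x, t) ∈ domain a b) :
    ∃ (X : ℝ → ℝ) (T : ℝ), t < T ∧ X t = x ∧
      (IsCurve (domain a b) (fun z => u z + c z) (Iio T) X ∨
      ∃ e < t, IsCurve (domain a b) (fun z => u z + c z) (Ioo e T) X ∧
        ContinuousOn X (Ico e T) ∧ X e = a e) := by
  obtain ⟨M, -, hM⟩ := h.exists_speed_bound
  obtain ⟨X, T, htT, hXt, hX⟩ := exists_backward_isCurve h.continuous_left h.continuous_right
    h.smooth_two (fun z hz => (hM z hz).2.2.2) hx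
  refine ⟨X, T, htT, hXt, hX.imp_right ?_⟩
  rintro ⟨e, het, hXc, hcont, hend | hend⟩
  · exact ⟨e, het, hXc, hcont, hend⟩
  · have hchar : IsCharacteristic (domain a b) (fun z => u z + c z) (Icc e t) X :=
      ⟨ordConnected_Icc, hcont.mono (Icc_subset_Ico_right htT),
        fun τ hτ => (hXc τ (by rw [interior_Icc] at hτ; exact ⟨hτ.1, hτ.2.trans htT⟩)).1,
        fun τ hτ => (hXc τ (by rw [interior_Icc] at hτ; exact ⟨hτ.1, hτ.2.trans htT⟩)).2⟩
    have := (h.char_two_right _ _ hchar e (left_mem_Icc.2 het.le) hend).2 (right_mem_Icc.2 het.le)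
    exact absurd this (not_le.2 het)

/-- A 2-characteristic followed forwards in time lives forever or reaches the right boundary. -/
theorem Flow.exists_forward_two (h : Flow κ a b ρ u c) {x t : ℝ} (hx : (x, t) ∈ domain a b) :
    ∃ (X : ℝ → ℝ) (T : ℝ), T < t ∧ X t = x ∧
      (IsCurve (domain a b) (fun z => u z + c z) (Ioi T) X ∨
      ∃ f > t, IsCurve (domain a b) (fun z => u z + c z) (Ioo T f) X ∧
        ContinuousOn X (Ioc T f) ∧ X f = b f) := by
  have hσ : (-1 : ℝ) * -1 = 1 := by norm_num
  obtain ⟨X, T, htT, hXt, hX⟩ := (h.reflect hσ).exists_backward_two (x := -x) (t := -t)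
    ((mem_domain_refl _).2 (by simpa using hx))
  have key : ∀ {I : Set ℝ}, IsCurve (domain (fun t => -b (-1 * t)) (fun t => -a (-1 * t)))
      (fun z => -(-1) * u (GasFlow.refl (-1) z) + c (GasFlow.refl (-1) z)) I X →
      IsCurve (domain a b) (fun z => u z + c z) ((fun s => -1 * s) ⁻¹' I)
        (fun s => -X (-1 * s)) := fun hI => hI.refl hσ (fun z => by ring)
  refine ⟨fun s => -X (-1 * s), -T, by linarith, by simp [hXt], ?_⟩
  rcases hX with hX | ⟨e, het, hX, hc, he⟩
  · refine Or.inl ((key hX).mono fun s hs => ?_)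
    simp only [mem_preimage, mem_Iio, mem_Ioi] at hs ⊢
    linarith
  · refine Or.inr ⟨-e, by linarith, (key hX).mono fun s hs => ?_, ?_, by simp [he]⟩
    · simp only [mem_preimage, mem_Ioo] at hs ⊢
      exact ⟨by linarith, by linarith⟩
    · refine (hc.comp (g := X) (f := fun s => -1 * s) (by fun_prop) fun s hs => ?_).neg
      exact ⟨by linarith [hs.2], by linarith [hs.1]⟩

/-- A 1-characteristic followed backwards in time lives forever or reaches the right boundary. -/
theorem Flow.exists_backward_one (h : Flow κ a b ρ u c) {x t : ℝ} (hx : (x, t) ∈ domain a b) :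
    ∃ (X : ℝ → ℝ) (T : ℝ), t < T ∧ X t = x ∧
      (IsCurve (domain a b) (fun z => u z - c z) (Iio T) X ∨
      ∃ e < t, IsCurve (domain a b) (fun z => u z - c z) (Ioo e T) X ∧
        ContinuousOn X (Ico e T) ∧ X e = b e) := by
  have hσ : (1 : ℝ) * 1 = 1 := by norm_num
  obtain ⟨X, T, htT, hXt, hX⟩ := (h.reflect hσ).exists_backward_two (x := -x) (t := t)
    ((mem_domain_refl _).2 (by simpa using hx))
  have key : ∀ {I : Set ℝ}, IsCurve (domain (fun t => -b (1 * t)) (fun t => -a (1 * t)))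
      (fun z => -1 * u (GasFlow.refl 1 z) + c (GasFlow.refl 1 z)) I X →
      IsCurve (domain a b) (fun z => u z - c z) ((fun s => 1 * s) ⁻¹' I)
        (fun s => -X (1 * s)) := fun hI => hI.refl hσ (fun z => by ring)
  refine ⟨fun s => -X (1 * s), T, htT, by simp [hXt], ?_⟩
  rcases hX with hX | ⟨e, het, hX, hc, he⟩
  · exact Or.inl ((key hX).mono fun s hs => by simpa using hs)
  · refine Or.inr ⟨e, het, (key hX).mono fun s hs => by simpa using hs, ?_, by simp [he]⟩
    exact (hc.comp (g := X) (f := fun s => 1 * s) (by fun_prop) fun s hs => by simpa using hs).neg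

/-- The Riemann invariant `u + c / κ` is constant along 2-characteristics. -/
theorem Flow.riemann_two (h : Flow κ a b ρ u c) {I : Set ℝ} (hI : I.OrdConnected) {X : ℝ → ℝ}
    (hX : IsCurve (domain a b) (fun z => u z + c z) I X) {s t : ℝ} (hs : s ∈ I) (ht : t ∈ I) :
    u (X t, t) + c (X t, t) / κ = u (X s, s) + c (X s, s) / κ := by
  have hκ := h.kappa_pos.ne'
  have hd : ∀ τ ∈ I, HasDerivWithinAt (fun τ => u (X τ, τ) + c (X τ, τ) / κ) 0 I τ := by
    intro τ hτ
    obtain ⟨hm, hX'⟩ := hX τ hτ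
    have hu := hasDerivAt_along (h.differentiableAt h.smooth_velocity hm) hX'
    have hc := hasDerivAt_along (h.differentiableAt h.smooth_sound hm) hX'
    refine ((hu.add (hc.div_const κ)).congr_deriv ?_).hasDerivWithinAt
    have e1 := h.eq_velocity _ hm
    have e2 := h.eq_sound _ hm
    field_simp at e1 ⊢
    linear_combination e1 + e2
  have := hI.convex.norm_image_sub_le_of_norm_hasDerivWithin_le hd (C := 0)
    (fun τ _ => by simp) hs ht
  simpa [sub_eq_zero] using this

/-- The Riemann invariant `u - c / κ` is constant along 1-characteristics. -/
theorem Flow.riemann_one (h : Flow κ a b ρ u c) {I : Set ℝ} (hI : I.OrdConnected) {X : ℝ → ℝ}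
    (hX : IsCurve (domain a b) (fun z => u z - c z) I X) {s t : ℝ} (hs : s ∈ I) (ht : t ∈ I) :
    u (X t, t) - c (X t, t) / κ = u (X s, s) - c (X s, s) / κ := by
  have hκ := h.kappa_pos.ne'
  have hd : ∀ τ ∈ I, HasDerivWithinAt (fun τ => u (X τ, τ) - c (X τ, τ) / κ) 0 I τ := by
    intro τ hτ
    obtain ⟨hm, hX'⟩ := hX τ hτ
    have hu := hasDerivAt_along (h.differentiableAt h.smooth_velocity hm) hX'
    have hc := hasDerivAt_along (h.differentiableAt h.smooth_sound hm) hX'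
    refine ((hu.sub (hc.div_const κ)).congr_deriv ?_).hasDerivWithinAt
    have e1 := h.eq_velocity _ hm
    have e2 := h.eq_sound _ hm
    field_simp at e1 ⊢
    linear_combination e1 - e2
  have := hI.convex.norm_image_sub_le_of_norm_hasDerivWithin_le hd (C := 0)
    (fun τ _ => by simp) hs ht
  simpa [sub_eq_zero] using this

/-! ### Boundary velocities -/

lemma ae_differentiableAt_of_convexOn {f : ℝ → ℝ} (hf : ConvexOn ℝ univ f) :
    ∀ᵐ t, DifferentiableAt ℝ f t := by
  have hloc : LocallyBoundedVariationOn f univ := by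
    intro p q _ _
    obtain ⟨K, hK⟩ := hf.locallyLipschitz.locallyLipschitzOn.exists_lipschitzOnWith_of_compact
      (isCompact_Icc (a := p) (b := q))
    rw [univ_inter]
    rcases le_or_gt p q with hpq | hpq
    · have := hK.locallyBoundedVariationOn p q (left_mem_Icc.2 hpq) (right_mem_Icc.2 hpq)
      rwa [inter_self] at this
    · rw [Icc_eq_empty (not_le.2 hpq)]
      simp [BoundedVariationOn]
  exact hloc.ae_differentiableAt

lemma deriv_le_deriv_of_convexOn {f : ℝ → ℝ} (hf : ConvexOn ℝ univ f) {s t : ℝ} (hst : s ≤ t)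
    (hs : DifferentiableAt ℝ f s) (ht : DifferentiableAt ℝ f t) : deriv f s ≤ deriv f t := by
  rcases hst.eq_or_lt with rfl | hst
  · rfl
  · exact (hf.deriv_le_slope (mem_univ _) (mem_univ _) hst hs).trans
      (hf.slope_le_deriv (mem_univ _) (mem_univ _) hst ht)

lemma exists_mem_Ioo_of_ae {P : ℝ → Prop} (hP : ∀ᵐ t, P t) {p q : ℝ} (hpq : p < q) :
    ∃ t ∈ Ioo p q, P t := by
  by_contra! hcon
  have h0 : volume (Ioo p q) = 0 := measure_mono_null (fun t ht => hcon t ht) hP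
  simp only [Real.volume_Ioo, ENNReal.ofReal_eq_zero] at h0
  linarith

lemma Flow.neBot_right (h : Flow κ a b ρ u c) (t : ℝ) : (𝓝[domain a b] (b t, t)).NeBot := by
  have h1 : Tendsto (fun x : ℝ => (x, t)) (𝓝[<] (b t)) (𝓝[domain a b] (b t, t)) := by
    refine tendsto_nhdsWithin_iff.2 ⟨?_, ?_⟩
    · exact (Continuous.prodMk_left t).continuousAt.tendsto.mono_left nhdsWithin_le_nhds
    · filter_upwards [Ioo_mem_nhdsLT (h.nonempty t)] with x hx using hx
  exact h1.neBot

/-- At a boundary time `t` where `b` is differentiable and the gas rarefies, the invariant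
`u - c / κ` is asymptotically at least `b'(t)`: otherwise some 2-characteristic, which moves with
nearly this speed, would come out of the right boundary. -/
theorem Flow.eventually_deriv_sub_le (h : Flow κ a b ρ u c) {t : ℝ} (hb : DifferentiableAt ℝ b t)
    (hc : Tendsto c (𝓝[domain a b] (b t, t)) (𝓝 0)) {ε : ℝ} (hε : 0 < ε) :
    ∀ᶠ z in 𝓝[domain a b] (b t, t), deriv b t - ε ≤ u z - c z / κ := by
  have hκ := h.kappa_pos
  obtain ⟨M, hM0, hM⟩ := h.exists_speed_bound
  set β := deriv b t with hβ
  set m := (b t - a t) / 2 with hm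
  have hm0 : 0 < m := by have := h.nonempty t; simp only [hm]; linarith
  -- `δ` is a smallness threshold for the sound speed.
  set δ := ε / 2 / (2 / κ + 1) with hδ
  have hδ0 : 0 < δ := by positivity
  have hδe : (2 / κ + 1) * δ = ε / 2 := by
    simp only [hδ]; field_simp
  obtain ⟨r₁, hr₁, H₁⟩ : ∃ r > 0, ∀ z, dist z (b t, t) < r → z ∈ domain a b → c z < δ := by
    have := hc.eventually (gt_mem_nhds hδ0)
    rw [eventually_nhdsWithin_iff, Metric.eventually_nhds_iff] at this
    obtain ⟨r, hr, H⟩ := this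
    exact ⟨r, hr, fun z hz hz' => H hz hz'⟩
  obtain ⟨r₂, hr₂, H₂⟩ : ∃ r > 0, ∀ s, dist s t < r →
      b s ≤ b t + β * (s - t) + ε / 4 * |s - t| := by
    have := (hb.hasDerivAt.isLittleO.def (show 0 < ε / 4 by positivity))
    rw [Metric.eventually_nhds_iff] at this
    obtain ⟨r, hr, H⟩ := this
    refine ⟨r, hr, fun s hs => ?_⟩
    have := (le_abs_self _).trans (H hs)
    simp only [smul_eq_mul, Real.norm_eq_abs] at this
    linarith
  obtain ⟨r₃, hr₃, H₃⟩ : ∃ r > 0, ∀ s, dist s t < r → a s < b t - m := by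
    have := h.continuous_left.continuousAt.eventually (gt_mem_nhds (show a t < b t - m by
      simp only [hm]; linarith))
    rw [Metric.eventually_nhds_iff] at this
    obtain ⟨r, hr, H⟩ := this
    exact ⟨r, hr, fun s hs => H hs⟩
  set R := min (min r₁ r₂) (min r₃ m) with hR
  have hR0 : 0 < R := by positivity
  have hRr₁ : R ≤ r₁ := (min_le_left _ _).trans (min_le_left _ _)
  have hRr₂ : R ≤ r₂ := (min_le_left _ _).trans (min_le_right _ _)
  have hRr₃ : R ≤ r₃ := (min_le_right _ _).trans (min_le_left _ _)
  have hRm : R ≤ m := (min_le_right _ _).trans (min_le_right _ _)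
  -- Follow a 2-characteristic backwards during the time `l`.
  set l := R / (2 * (M + 2)) with hl
  have hl0 : 0 < l := by positivity
  have hlR : (M + 2) * l = R / 2 := by
    simp only [hl]; field_simp
  set η := min l (ε * l / 8 / (1 + |β| + ε)) with hη
  have hη0 : 0 < η := by positivity
  have hηl : η ≤ l := min_le_left _ _
  have hη' : (1 + |β| + ε) * η ≤ ε * l / 8 := by
    have h1 : η ≤ ε * l / 8 / (1 + |β| + ε) := min_le_right _ _
    rwa [le_div_iff₀ (by positivity), mul_comm] at h1
  rw [eventually_nhdsWithin_iff, Metric.eventually_nhds_iff]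
  refine ⟨η, hη0, ?_⟩
  rintro ⟨x₁, t₁⟩ hdist hQ
  rw [Prod.dist_eq, max_lt_iff, Real.dist_eq, Real.dist_eq] at hdist
  simp only at hdist
  obtain ⟨hdx, hdt⟩ := hdist
  by_contra! hcon
  obtain ⟨X, T, htT, hXt, hX⟩ := h.exists_backward_two hQ
  have hMl : M * l + 2 * l = R / 2 := by linarith
  have hdx' := abs_lt.1 hdx
  have hdt' := abs_lt.1 hdt
  -- As long as it lives the curve stays in the region where `c` is small.
  have hfar : ∀ s, t₁ - l ≤ s → s ≤ t₁ → IsCurve (domain a b) (fun z => u z + c z) (Icc s t₁) X →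
      x₁ - X s ≤ (β - ε / 2) * (t₁ - s) ∧ x₁ - X s ≤ M * l := by
    intro s hs hst hcv
    have hloc : ∀ τ ∈ Icc s t₁, c (X τ, τ) < δ := by
      intro τ hτ
      refine H₁ _ ?_ (hcv τ hτ).1
      have h1 := IsCurve.abs_sub_le (fun z hz => (hM z hz).2.2.2) ordConnected_Icc hcv hτ
        (right_mem_Icc.2 hst)
      rw [hXt, abs_of_nonneg (a := t₁ - τ) (by linarith [hτ.2])] at h1
      have h2 : M * (t₁ - τ) ≤ M * l := by
        apply mul_le_mul_of_nonneg_left _ hM0.le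
        linarith [hτ.1]
      have h3 := abs_le.1 (h1.trans h2)
      rw [Prod.dist_eq, max_lt_iff, Real.dist_eq, Real.dist_eq, abs_lt, abs_lt]
      refine ⟨⟨?_, ?_⟩, ?_, ?_⟩ <;> simp only <;> linarith [hτ.1, hτ.2, h3.1, h3.2]
    constructor
    · rw [← hXt]
      refine hcv.sub_le hst fun τ hτ => ?_
      have e1 := h.riemann_two ordConnected_Icc hcv hτ (right_mem_Icc.2 hst)
      rw [hXt] at e1
      have e2 := hloc τ hτ
      have e3 := hloc t₁ (right_mem_Icc.2 hst)
      rw [hXt] at e3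
      have e4 := h.sound_pos _ (hcv τ hτ).1
      have e5 : 0 < c (X τ, τ) / κ := by positivity
      have e6 : c (x₁, t₁) / κ ≤ δ / κ := by gcongr
      have e7 : 2 / κ * δ = 2 * (δ / κ) := by ring
      linarith
    · have h1 := IsCurve.abs_sub_le (fun z hz => (hM z hz).2.2.2) ordConnected_Icc hcv
        (left_mem_Icc.2 hst) (right_mem_Icc.2 hst)
      rw [hXt, abs_of_nonneg (a := t₁ - s) (by linarith)] at h1
      refine (le_abs_self _).trans (h1.trans ?_)
      apply mul_le_mul_of_nonneg_left _ hM0.le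
      linarith
  -- Going back by `l` leads beyond the right boundary.
  have hcross : ¬ IsCurve (domain a b) (fun z => u z + c z) (Icc (t₁ - l) t₁) X := by
    intro hcv
    have h1 := (hfar _ le_rfl (by linarith) hcv).1
    have h2 : X (t₁ - l) < b (t₁ - l) := (hcv (t₁ - l) ⟨le_rfl, by linarith⟩).1.2
    have habs : |t₁ - l - t| ≤ l + η := by
      rw [abs_le]; constructor <;> linarith
    have h3 := H₂ (t₁ - l) (by
      rw [Real.dist_eq]
      have := mul_pos hM0 hl0
      linarith)
    have h4 : ε / 4 * |t₁ - l - t| ≤ ε / 4 * (l + η) :=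
      mul_le_mul_of_nonneg_left habs (by positivity)
    have h5 : β * (t₁ - t) ≤ |β| * η := by
      refine (le_abs_self _).trans ?_
      rw [abs_mul]
      exact mul_le_mul_of_nonneg_left hdt.le (abs_nonneg _)
    have h6 : (1 + |β| + ε) * η = η + |β| * η + ε * η := by ring
    have h7 : (β - ε / 2) * (t₁ - (t₁ - l)) = β * l - ε * l / 2 := by ring
    have h8 : β * (t₁ - l - t) = β * (t₁ - t) - β * l := by ring
    have h9 : 0 < ε * l := by positivity
    have h10 : 0 < ε * η := by positivity
    have h11 : ε / 4 * (l + η) = ε * l / 4 + ε * η / 4 := by ring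
    linarith
  rcases hX with hX | ⟨e, het, hX, hcont, hend⟩
  · exact hcross (hX.mono fun s hs => lt_of_le_of_lt hs.2 htT)
  · rcases lt_or_ge e (t₁ - l) with hel | hel
    · exact hcross (hX.mono fun s hs => ⟨by linarith [hs.1], lt_of_le_of_lt hs.2 htT⟩)
    · -- The left boundary is too far away to be reached in this time.
      have hlim : x₁ - X e ≤ M * l := by
        have hcw : Tendsto (fun s => x₁ - X s) (𝓝[>] e) (𝓝 (x₁ - X e)) :=
          tendsto_const_nhds.sub ((hcont e ⟨le_rfl, het.trans htT⟩).mono_left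
            (by rw [← nhdsWithin_Ioo_eq_nhdsGT (het.trans htT)]
                exact nhdsWithin_mono _ Ioo_subset_Ico_self))
        refine le_of_tendsto hcw ?_
        filter_upwards [Ioo_mem_nhdsGT het] with s hs
        exact (hfar s (by linarith [hs.1]) hs.2.le
          (hX.mono fun τ hτ => ⟨by linarith [hs.1, hτ.1], by linarith [hτ.2]⟩)).2
      have := H₃ e (by
        rw [Real.dist_eq, abs_lt]
        have := mul_pos hM0 hl0
        constructor <;> linarith)
      have := mul_pos hM0 hl0
      rw [hend] at hlim
      linarith

/-- Mirror image of `Flow.eventually_deriv_sub_le`. -/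
theorem Flow.eventually_le_deriv_add (h : Flow κ a b ρ u c) {t : ℝ} (ha : DifferentiableAt ℝ a t)
    (hc : Tendsto c (𝓝[domain a b] (a t, t)) (𝓝 0)) {ε : ℝ} (hε : 0 < ε) :
    ∀ᶠ z in 𝓝[domain a b] (a t, t), u z + c z / κ ≤ deriv a t + ε := by
  have hσ : (1 : ℝ) * 1 = 1 := by norm_num
  have h' := h.reflect hσ
  simp only [one_mul] at h'
  have hc' := tendsto_comp_refl (σ := 1) (t := t) (x := a t) (f := c) (a := a) (b := b)
    (by simpa using hc)
  simp only [one_mul] at hc'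
  have := h'.eventually_deriv_sub_le ha.neg hc' hε
  have hmap : Tendsto (GasFlow.refl 1) (𝓝[domain a b] (a t, t))
      (𝓝[domain (fun t => -b t) (fun t => -a t)] (-a t, t)) := by
    refine tendsto_nhdsWithin_iff.2 ⟨?_, ?_⟩
    · have := (GasFlow.refl 1).continuous.tendsto (a t, t)
      rw [refl_apply, one_mul] at this
      exact this.mono_left nhdsWithin_le_nhds
    · refine eventually_nhdsWithin_of_forall fun z hz => ?_
      have := (mem_domain_refl (a := a) (b := b) (σ := 1) (GasFlow.refl 1 z)).2
        (by rwa [refl_refl hσ])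
      simpa using this
  filter_upwards [hmap.eventually this] with z hz
  rw [refl_refl hσ, show deriv (fun t => -a t) t = -deriv a t from deriv.neg] at hz
  linarith

/-- Times at which the right boundary is differentiable and the gas rarefies near it. -/
lemma Flow.ae_good_right (h : Flow κ a b ρ u c) : ∀ᵐ t : ℝ, DifferentiableAt ℝ b t ∧
    Tendsto ρ (𝓝[domain a b] (b t, t)) (𝓝 0) ∧ Tendsto c (𝓝[domain a b] (b t, t)) (𝓝 0) := by
  filter_upwards [ae_differentiableAt_of_convexOn h.convex_right, h.vacuum_right] with t h1 h2
    using ⟨h1, h2⟩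

lemma Flow.ae_good_left (h : Flow κ a b ρ u c) : ∀ᵐ t : ℝ, DifferentiableAt ℝ a t ∧
    Tendsto ρ (𝓝[domain a b] (a t, t)) (𝓝 0) ∧ Tendsto c (𝓝[domain a b] (a t, t)) (𝓝 0) := by
  filter_upwards [ae_differentiableAt_of_convexOn h.convex_left, h.vacuum_left] with t h1 h2
  exact ⟨by simpa using h1.fun_neg, h2⟩

theorem Flow.exists_deriv_right_le (h : Flow κ a b ρ u c) :
    ∃ M, ∀ t, DifferentiableAt ℝ b t → deriv b t ≤ M := by
  obtain ⟨M, hM0, hM⟩ := h.exists_speed_bound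
  refine ⟨M + 1, fun t ht => ?_⟩
  obtain ⟨s, hs, hds, -, hcs⟩ := exists_mem_Ioo_of_ae h.ae_good_right (show t < t + 1 by linarith)
  refine (deriv_le_deriv_of_convexOn h.convex_right hs.1.le ht hds).trans ?_
  have := h.neBot_right s
  obtain ⟨z, hz1, hz2⟩ := ((h.eventually_deriv_sub_le hds hcs one_pos).and
    self_mem_nhdsWithin).exists
  have h1 := (abs_le.1 (hM z hz2).2.1).2
  have h2 : 0 < c z / κ := div_pos (h.sound_pos z hz2) h.kappa_pos
  linarith

/-! ### Balance laws between two moving curves -/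

lemma continuousOn_slice {f : ℝ × ℝ → ℝ} (hf : ContinuousOn f (domain a b)) {x y t : ℝ}
    (hx : (x, t) ∈ domain a b) (hy : (y, t) ∈ domain a b) :
    ContinuousOn (fun z => f (z, t)) (uIcc x y) :=
  hf.comp (by fun_prop) fun _ hz => segment_mem_domain hx hy hz

/-- Derivative of an integral whose upper end moves. -/
lemma hasDerivAt_integral_moving_end (hU : IsOpen (domain a b)) {g : ℝ × ℝ → ℝ}
    (hg : ContinuousOn g (domain a b)) {Y : ℝ → ℝ} {s y' : ℝ} (hmem : (Y s, s) ∈ domain a b)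
    (hY : HasDerivAt Y y' s) :
    HasDerivAt (fun τ => ∫ y in Y s..Y τ, g (y, τ)) (g (Y s, s) * y') s := by
  set y₀ := Y s with hy₀
  have hlin : HasDerivAt (fun τ => g (y₀, s) * (Y τ - y₀)) (g (y₀, s) * y') s :=
    (hY.sub_const y₀).const_mul _
  have hrem : HasDerivAt (fun τ => ∫ y in y₀..Y τ, (g (y, τ) - g (y₀, s))) 0 s := by
    rw [hasDerivAt_iff_isLittleO]
    simp only [← hy₀, intervalIntegral.integral_same, smul_zero, sub_zero]
    have hO : (fun τ => Y τ - y₀) =O[𝓝 s] fun τ => τ - s := hY.isBigO_sub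
    refine Asymptotics.IsLittleO.trans_isBigO ?_ hO
    rw [Asymptotics.isLittleO_iff]
    intro ε hε
    have hcont : ContinuousAt g (y₀, s) := hg.continuousAt (hU.mem_nhds hmem)
    have hev := hcont.eventually (Metric.ball_mem_nhds _ hε)
    rw [Metric.eventually_nhds_iff] at hev
    obtain ⟨r, hr, H⟩ := hev
    filter_upwards [hY.continuousAt.eventually (Metric.ball_mem_nhds _ hr),
      Metric.ball_mem_nhds s hr] with τ h1 h2
    refine (intervalIntegral.norm_integral_le_of_norm_le_const fun y hy => ?_)
    have hd : dist (y, τ) (y₀, s) < r := by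
      rw [Prod.dist_eq]
      refine max_lt ?_ h2
      refine lt_of_le_of_lt ?_ h1
      rw [Real.dist_eq, Real.dist_eq]
      exact abs_sub_left_of_mem_uIcc (uIoc_subset_uIcc hy)
    rw [← dist_eq_norm]
    exact (H hd).le
  refine (hlin.add hrem).congr_of_eventuallyEq ?_ |>.congr_deriv (add_zero _)
  have hpair : ContinuousAt (fun τ => (Y τ, τ)) s := hY.continuousAt.prodMk continuousAt_id
  have hpair' : ContinuousAt (fun τ => (y₀, τ)) s := by fun_prop
  filter_upwards [hpair.eventually_mem (hU.mem_nhds hmem),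
    hpair'.eventually_mem (hU.mem_nhds hmem)] with τ h1 h2
  have hint : IntervalIntegrable (fun y => g (y, τ)) volume y₀ (Y τ) :=
    (continuousOn_slice hg h2 h1).intervalIntegrable
  simp only [Pi.add_apply]
  rw [intervalIntegral.integral_sub hint intervalIntegrable_const,
    intervalIntegral.integral_const, smul_eq_mul]
  ring

/-- Differentiation under the integral sign over a fixed horizontal segment. -/
lemma hasDerivAt_integral_fixed_ends (hU : IsOpen (domain a b)) {g : ℝ × ℝ → ℝ}
    (hg : ContDiffOn ℝ 1 g (domain a b)) {x y s : ℝ} (hx : (x, s) ∈ domain a b)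
    (hy : (y, s) ∈ domain a b) :
    HasDerivAt (fun τ => ∫ z in x..y, g (z, τ)) (∫ z in x..y, fderiv ℝ g (z, s) (0, 1)) s := by
  set K : Set (ℝ × ℝ) := (fun z => (z, s)) '' uIcc x y with hK
  have hKc : IsCompact K := isCompact_uIcc.image (by fun_prop)
  have hKU : K ⊆ domain a b := by
    rintro _ ⟨z, hz, rfl⟩
    exact segment_mem_domain hx hy hz
  obtain ⟨δ, hδ, hth⟩ := hKc.exists_cthickening_subset_open hU hKU
  have hcont : ContinuousOn (fun z => fderiv ℝ g z (0, 1)) (domain a b) :=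
    (hg.continuousOn_fderiv_of_isOpen hU le_rfl).clm_apply continuousOn_const
  obtain ⟨C, hC⟩ := hKc.cthickening.exists_bound_of_continuousOn (hcont.mono hth)
  have hmem : ∀ z ∈ uIcc x y, ∀ τ ∈ Metric.ball s δ, (z, τ) ∈ Metric.cthickening δ K := by
    intro z hz τ hτ
    refine Metric.mem_cthickening_of_dist_le (z, τ) (z, s) δ K ⟨z, hz, rfl⟩ ?_
    rw [Prod.dist_eq, dist_self]
    exact max_le hδ.le (Metric.mem_ball.1 hτ).le
  refine (intervalIntegral.hasDerivAt_integral_of_dominated_loc_of_deriv_le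
    (F := fun τ z => g (z, τ)) (F' := fun τ z => fderiv ℝ g (z, τ) (0, 1)) (bound := fun _ => C)
    (Metric.ball_mem_nhds s hδ) ?_ ?_ ?_ ?_ intervalIntegrable_const ?_).2
  · filter_upwards [Metric.ball_mem_nhds s hδ] with τ hτ
    exact (continuousOn_slice hg.continuousOn (hth (hmem x left_mem_uIcc τ hτ))
      (hth (hmem y right_mem_uIcc τ hτ))).intervalIntegrable.def'.aestronglyMeasurable
  · exact (continuousOn_slice hg.continuousOn hx hy).intervalIntegrable
  · exact (continuousOn_slice hcont hx hy).intervalIntegrable.def'.aestronglyMeasurable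
  · exact ae_of_all _ fun z hz τ hτ => hC _ (hmem z (uIoc_subset_uIcc hz) τ hτ)
  · refine ae_of_all _ fun z hz τ hτ => ?_
    have hm := hth (hmem z (uIoc_subset_uIcc hz) τ hτ)
    have := hasDerivAt_along (X := fun _ => z)
      ((hg.contDiffAt (hU.mem_nhds hm)).differentiableAt one_ne_zero) (hasDerivAt_const τ z)
    simpa using this

/-- The transport formula: the rate of change of `∫ g dx` between two moving points, when
`∂ₜg + ∂ₓf = r`, is the total source plus the net flux through the two moving ends. -/
theorem hasDerivAt_integral_between (hU : IsOpen (domain a b)) {g f r : ℝ × ℝ → ℝ}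
    (hg : ContDiffOn ℝ 1 g (domain a b)) (hf : ContDiffOn ℝ 1 f (domain a b))
    (hr : ∀ z ∈ domain a b, fderiv ℝ g z (0, 1) + fderiv ℝ f z (1, 0) = r z)
    {X Y : ℝ → ℝ} {s x' y' : ℝ} (hXm : (X s, s) ∈ domain a b) (hYm : (Y s, s) ∈ domain a b)
    (hX : HasDerivAt X x' s) (hY : HasDerivAt Y y' s) :
    HasDerivAt (fun τ => ∫ z in X τ..Y τ, g (z, τ))
      ((∫ z in X s..Y s, r (z, s)) + (g (Y s, s) * y' - f (Y s, s))
        - (g (X s, s) * x' - f (X s, s))) s := by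
  have h1 := hasDerivAt_integral_fixed_ends hU hg hXm hYm
  have h2 := hasDerivAt_integral_moving_end hU hg.continuousOn hXm hX
  have h3 := hasDerivAt_integral_moving_end hU hg.continuousOn hYm hY
  have hflux : ∫ z in X s..Y s, fderiv ℝ f (z, s) (1, 0) = f (Y s, s) - f (X s, s) := by
    refine intervalIntegral.integral_eq_sub_of_hasDerivAt (f := fun z => f (z, s)) (fun z hz => ?_)
      ?_
    · exact hasDerivAt_slice ((hf.contDiffAt (hU.mem_nhds
        (segment_mem_domain hXm hYm hz))).differentiableAt one_ne_zero)
    · exact (continuousOn_slice ((hf.continuousOn_fderiv_of_isOpen hU le_rfl).clm_apply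
        continuousOn_const) hXm hYm).intervalIntegrable
  have hgt : ∫ z in X s..Y s, fderiv ℝ g (z, s) (0, 1)
      = (∫ z in X s..Y s, r (z, s)) - (f (Y s, s) - f (X s, s)) := by
    have hi1 : IntervalIntegrable (fun z => fderiv ℝ g (z, s) (0, 1)) volume (X s) (Y s) :=
      (continuousOn_slice ((hg.continuousOn_fderiv_of_isOpen hU le_rfl).clm_apply
        continuousOn_const) hXm hYm).intervalIntegrable
    have hi2 : IntervalIntegrable (fun z => fderiv ℝ f (z, s) (1, 0)) volume (X s) (Y s) :=
      (continuousOn_slice ((hf.continuousOn_fderiv_of_isOpen hU le_rfl).clm_apply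
        continuousOn_const) hXm hYm).intervalIntegrable
    rw [← hflux, eq_sub_iff_add_eq, ← intervalIntegral.integral_add hi1 hi2]
    exact intervalIntegral.integral_congr fun z hz => hr _ (segment_mem_domain hXm hYm hz)
  refine ((h1.add h3).sub h2).congr_of_eventuallyEq ?_ |>.congr_deriv (by rw [hgt]; ring)
  have hev : ∀ Z : ℝ → ℝ, ContinuousAt Z s → (Z s, s) ∈ domain a b →
      ∀ᶠ τ in 𝓝 s, (Z τ, τ) ∈ domain a b := fun Z hZ hm =>
    (hZ.prodMk continuousAt_id).eventually_mem (hU.mem_nhds hm)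
  filter_upwards [hev X hX.continuousAt hXm, hev Y hY.continuousAt hYm,
    hev (fun _ => X s) continuousAt_const hXm, hev (fun _ => Y s) continuousAt_const hYm]
    with τ e1 e2 e3 e4
  have hi : ∀ {p q : ℝ}, (p, τ) ∈ domain a b → (q, τ) ∈ domain a b →
      IntervalIntegrable (fun z => g (z, τ)) volume p q := fun hp hq =>
    (continuousOn_slice hg.continuousOn hp hq).intervalIntegrable
  simp only [Pi.add_apply, Pi.sub_apply]
  rw [intervalIntegral.integral_add_adjacent_intervals (hi e3 e4) (hi e4 e2),
    ← intervalIntegral.integral_add_adjacent_intervals (hi e3 e1) (hi e1 e2)]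
  ring

/-! ### Eternal characteristics and conservation of mass -/

lemma Flow.mass_law (h : Flow κ a b ρ u c) {z : ℝ × ℝ} (hz : z ∈ domain a b) :
    fderiv ℝ ρ z (0, 1) + fderiv ℝ (fun z => ρ z * u z) z (1, 0) = 0 := by
  have h1 := h.differentiableAt h.smooth_density hz
  have h2 := h.differentiableAt h.smooth_velocity hz
  rw [fderiv_fun_mul h1 h2]
  have := h.mass z hz
  simp only [_root_.add_apply, _root_.smul_apply, smul_eq_mul]
  linarith

lemma Flow.intervalIntegrable_density (h : Flow κ a b ρ u c) {x t : ℝ}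
    (hx : (x, t) ∈ domain a b) : IntervalIntegrable (fun y => ρ (y, t)) volume (a t) x := by
  obtain ⟨M, hM0, hM⟩ := h.exists_speed_bound
  rw [intervalIntegrable_iff_integrableOn_Ioc_of_le hx.1.le]
  refine Measure.integrableOn_of_bounded (M := M) (by simp) ?_ ?_
  · exact (h.measurable_density.comp measurable_prodMk_right).aestronglyMeasurable
  · refine (ae_restrict_iff' measurableSet_Ioc).2 (ae_of_all _ fun y hy => ?_)
    have hm : (y, t) ∈ domain a b := ⟨hy.1, hy.2.trans_lt hx.2⟩
    rw [Real.norm_of_nonneg (h.density_pos _ hm).le]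
    exact (hM _ hm).1

lemma Flow.continuousOn_flux (h : Flow κ a b ρ u c) {X : ℝ → ℝ} {I : Set ℝ}
    (hX : IsCurve (domain a b) (fun z => u z + c z) I X) :
    ContinuousOn (fun r => ρ (X r, r) * c (X r, r)) I :=
  (h.smooth_density.continuousOn.mul h.smooth_sound.continuousOn).comp
    (hX.continuousOn.prodMk continuousOn_id) fun r hr => (hX r hr).1

/-- The mass to the left of a 2-characteristic changes only by the flux `ρ c` through the
characteristic, up to an error controlled by the size of `ρ` near the left boundary. -/
lemma Flow.mass_error (h : Flow κ a b ρ u c) {X : ℝ → ℝ} {T t₀ s t M L N : ℝ}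
    (hM : ∀ z ∈ domain a b, |u z| ≤ M)
    (hX : IsCurve (domain a b) (fun z => u z + c z) (Iio T) X) (ht₀ : t₀ < T) (hst : s < t)
    (htT : t < T) (hL : ∀ τ ∈ Icc s t, |a τ - a s| < L * (t - s))
    (hXL : ∀ τ ∈ Icc s t, a τ + 2 * (L * (t - s)) ≤ X τ)
    (hN : ∀ τ ∈ Icc s t, ∀ y, (y, τ) ∈ domain a b → y ≤ a s + L * (t - s) → ρ (y, τ) ≤ N) :
    |((∫ y in a t..X t, ρ (y, t)) + ∫ r in t..t₀, ρ (X r, r) * c (X r, r))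
      - ((∫ y in a s..X s, ρ (y, s)) + ∫ r in s..t₀, ρ (X r, r) * c (X r, r))|
      ≤ (M + 4 * L) * N * (t - s) := by
  have hU := h.isOpen
  have hts : 0 < t - s := by linarith
  have hL0 : 0 < L := by
    have := hL s (left_mem_Icc.2 hst.le)
    rw [sub_self, abs_zero] at this
    exact (pos_iff_pos_of_mul_pos this).2 hts
  -- The vertical line `x` lies in the domain, to the left of the characteristic.
  set x := a s + L * (t - s) with hx
  have hxU : ∀ τ ∈ Icc s t, (x, τ) ∈ domain a b := by
    intro τ hτ
    have h1 := abs_lt.1 (hL τ hτ)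
    have h2 := hXL τ hτ
    have h3 : X τ < b τ := (hX τ (lt_of_le_of_lt hτ.2 htT)).1.2
    exact ⟨by simp only; linarith, by simp only; linarith⟩
  have hIcc : ∀ τ ∈ Icc s t, τ < T := fun τ hτ => lt_of_le_of_lt hτ.2 htT
  have hN0 : 0 ≤ N := by
    have hm := hxU s (left_mem_Icc.2 hst.le)
    exact (h.density_pos _ hm).le.trans (hN s (left_mem_Icc.2 hst.le) x hm le_rfl)
  have hflux := h.continuousOn_flux hX
  set H : ℝ → ℝ := fun τ => (∫ y in x..X τ, ρ (y, τ)) + ∫ r in τ..t₀, ρ (X r, r) * c (X r, r)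
    with hH
  have hderiv : ∀ τ ∈ Icc s t, HasDerivAt H (ρ (x, τ) * u (x, τ)) τ := by
    intro τ hτ
    have hτT := hIcc τ hτ
    have h1 := hasDerivAt_integral_between hU h.smooth_density
      (h.smooth_density.mul h.smooth_velocity) (r := fun _ => 0) (fun z hz => h.mass_law hz)
      (X := fun _ => x) (Y := X) (hxU τ hτ) (hX τ hτT).1 (hasDerivAt_const τ x) (hX τ hτT).2
    have h2 : HasDerivAt (fun τ => ∫ r in τ..t₀, ρ (X r, r) * c (X r, r))
        (-(ρ (X τ, τ) * c (X τ, τ))) τ := by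
      refine intervalIntegral.integral_hasDerivAt_left ?_ ?_ ?_
      · refine (hflux.mono fun r hr => ?_).intervalIntegrable
        exact lt_of_le_of_lt hr.2 (max_lt hτT ht₀)
      · exact hflux.stronglyMeasurableAtFilter isOpen_Iio _ hτT
      · exact hflux.continuousAt (isOpen_Iio.mem_nhds hτT)
    refine (h1.add h2).congr_deriv ?_
    simp only [intervalIntegral.integral_zero]
    ring
  have hmain : |H t - H s| ≤ N * M * (t - s) := by
    have := (convex_Icc s t).norm_image_sub_le_of_norm_hasDerivWithin_le (f := H)
      (f' := fun τ => ρ (x, τ) * u (x, τ)) (C := N * M)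
      (fun τ hτ => (hderiv τ hτ).hasDerivWithinAt) (fun τ hτ => by
        have hm := hxU τ hτ
        rw [norm_mul, Real.norm_of_nonneg (h.density_pos _ hm).le]
        exact mul_le_mul (hN τ hτ x hm le_rfl) (hM _ hm) (abs_nonneg _) hN0)
      (left_mem_Icc.2 hst.le) (right_mem_Icc.2 hst.le)
    rwa [Real.norm_eq_abs, Real.norm_eq_abs, abs_of_pos hts] at this
  have hstrip : ∀ τ ∈ Icc s t, |∫ y in a τ..x, ρ (y, τ)| ≤ N * (2 * (L * (t - s))) := by
    intro τ hτ
    have h1 := abs_lt.1 (hL τ hτ)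
    have := intervalIntegral.norm_integral_le_of_norm_le_const (f := fun y => ρ (y, τ)) (C := N)
      (a := a τ) (b := x) (fun y hy => by
        rw [uIoc_of_le (hxU τ hτ).1.le] at hy
        have hm : (y, τ) ∈ domain a b := ⟨hy.1, hy.2.trans_lt (hxU τ hτ).2⟩
        rw [Real.norm_of_nonneg (h.density_pos _ hm).le]
        exact hN τ hτ y hm hy.2)
    rw [Real.norm_eq_abs] at this
    refine this.trans (mul_le_mul_of_nonneg_left ?_ hN0)
    rw [abs_of_pos (by have := (hxU τ hτ).1; simp only at this; linarith)]
    linarith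
  have hsplit : ∀ τ ∈ Icc s t, (∫ y in a τ..X τ, ρ (y, τ)) + ∫ r in τ..t₀, ρ (X r, r) * c (X r, r)
      = (∫ y in a τ..x, ρ (y, τ)) + H τ := by
    intro τ hτ
    have hm := (hX τ (hIcc τ hτ)).1
    rw [← intervalIntegral.integral_add_adjacent_intervals
      (h.intervalIntegrable_density (hxU τ hτ))
      (continuousOn_slice h.smooth_density.continuousOn (hxU τ hτ) hm).intervalIntegrable]
    simp only [hH]
    ring
  rw [hsplit t (right_mem_Icc.2 hst.le), hsplit s (left_mem_Icc.2 hst.le)]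
  have e1 := abs_le.1 (hstrip t (right_mem_Icc.2 hst.le))
  have e2 := abs_le.1 (hstrip s (left_mem_Icc.2 hst.le))
  have e3 := abs_le.1 hmain
  rw [abs_le]
  constructor <;> nlinarith [e1.1, e1.2, e2.1, e2.2, e3.1, e3.2]

/-- No mass is lost through the left boundary: the density vanishes at almost all of its points.
Hence the mass to the left of a 2-characteristic and the flux through it balance exactly. -/
theorem Flow.mass_balance (h : Flow κ a b ρ u c) {X : ℝ → ℝ} {T t₀ t : ℝ}
    (hX : IsCurve (domain a b) (fun z => u z + c z) (Iio T) X) (ht₀ : t₀ < T) (ht : t < T) :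
    (∫ y in a t..X t, ρ (y, t)) + ∫ r in t..t₀, ρ (X r, r) * c (X r, r)
      = ∫ y in a t₀..X t₀, ρ (y, t₀) := by
  obtain ⟨M, hM0, hM⟩ := h.exists_speed_bound
  set G : ℝ → ℝ := fun t => (∫ y in a t..X t, ρ (y, t)) + ∫ r in t..t₀, ρ (X r, r) * c (X r, r)
    with hG
  have hloc : ∀ σ < T, HasDerivAt G 0 σ := by
    intro σ hσ
    -- Near `σ` the boundary is Lipschitz and at a positive distance from the characteristic.
    obtain ⟨K, S, hS, hK⟩ := h.convex_left.locallyLipschitz σ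
    set m := X σ - a σ with hm
    have hm0 : 0 < m := by
      have : a σ < X σ := (hX σ hσ).1.1
      simp only [hm]; linarith
    have hgap : ∀ᶠ τ in 𝓝 σ, m / 2 < X τ - a τ :=
      ((hX σ hσ).2.continuousAt.sub h.continuous_left.continuousAt).eventually
        (lt_mem_nhds (show m / 2 < X σ - a σ by linarith))
    obtain ⟨r, hr, hball⟩ := Metric.eventually_nhds_iff.1
      ((hgap.and (eventually_mem_set.2 hS)).and (Iio_mem_nhds hσ))
    set L : ℝ := K + 1 with hL
    have hL0 : 0 < L := by positivity
    set δ := min (r / 2) (m / (8 * L)) with hδ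
    have hδ0 : 0 < δ := by positivity
    have hδL : 8 * (L * δ) ≤ m := by
      have : δ ≤ m / (8 * L) := min_le_right _ _
      rw [le_div_iff₀ (by positivity)] at this
      linarith
    have hIm : ∀ τ ∈ Icc (σ - δ) (σ + δ), m / 2 < X τ - a τ ∧ τ ∈ S ∧ τ < T := by
      intro τ hτ
      have hd : dist τ σ < r := by
        rw [Real.dist_eq, abs_lt]
        have : δ ≤ r / 2 := min_le_left _ _
        constructor <;> linarith [hτ.1, hτ.2]
      obtain ⟨⟨h1, h2⟩, h3⟩ := hball hd
      exact ⟨h1, h2, h3⟩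
    have hLip : ∀ τ ∈ Icc (σ - δ) (σ + δ), ∀ s ∈ Icc (σ - δ) (σ + δ),
        |a τ - a s| ≤ K * |τ - s| := by
      intro τ hτ s hs
      have := hK.dist_le_mul τ (hIm τ hτ).2.1 s (hIm s hs).2.1
      rw [Real.dist_eq, Real.dist_eq] at this
      rwa [show -a τ - -a s = -(a τ - a s) by ring, abs_neg] at this
    have herr : ∀ s ∈ Icc (σ - δ) (σ + δ), ∀ t ∈ Icc (σ - δ) (σ + δ), s < t → ∀ N,
        (∀ τ ∈ Icc s t, ∀ y, (y, τ) ∈ domain a b → y ≤ a s + L * (t - s) → ρ (y, τ) ≤ N) →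
        |G t - G s| ≤ (M + 4 * L) * N * (t - s) := by
      intro s hs t ht hst N hN
      have hsub : ∀ τ ∈ Icc s t, τ ∈ Icc (σ - δ) (σ + δ) := fun τ hτ =>
        ⟨hs.1.trans hτ.1, hτ.2.trans ht.2⟩
      refine h.mass_error (fun z hz => (hM z hz).2.1) hX ht₀ hst (hIm t ht).2.2 ?_ ?_ hN
      · intro τ hτ
        have h1 := hLip τ (hsub τ hτ) s hs
        rw [abs_of_nonneg (a := τ - s) (by linarith [hτ.1])] at h1
        have h2 : (K : ℝ) * (τ - s) ≤ K * (t - s) :=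
          mul_le_mul_of_nonneg_left (by linarith [hτ.2]) K.2
        rw [hL]
        linarith
      · intro τ hτ
        have h1 := (hIm τ (hsub τ hτ)).1
        have h2 : L * (t - s) ≤ L * (2 * δ) :=
          mul_le_mul_of_nonneg_left (by linarith [hs.1, ht.2]) hL0.le
        linarith
    have hLipG : LipschitzOnWith ((M + 4 * L) * M).toNNReal G (uIcc (σ - δ) (σ + δ)) := by
      rw [uIcc_of_le (by linarith)]
      refine LipschitzOnWith.of_dist_le_mul fun s hs t ht => ?_
      rw [Real.coe_toNNReal _ (by positivity)]
      wlog hst : s < t generalizing s t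
      · rcases (not_lt.1 hst).eq_or_lt with rfl | hlt
        · simp
        · rw [dist_comm, dist_comm s]
          exact this t ht s hs hlt
      rw [dist_comm, dist_comm s, Real.dist_eq, Real.dist_eq, abs_of_pos (a := t - s)
        (by linarith)]
      exact herr s hs t ht hst M fun τ _ y hy _ => (hM _ hy).1
    have hzero : ∀ᵐ τ, τ ∈ uIcc (σ - δ) (σ + δ) → τ ≠ σ - δ → τ ≠ σ + δ → HasDerivAt G 0 τ := by
      filter_upwards [h.ae_good_left] with τ hτ hτm hne1 hne2
      rw [uIcc_of_le (by linarith)] at hτm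
      obtain ⟨-, hρ, -⟩ := hτ
      have hτI : Ioo (σ - δ) (σ + δ) ∈ 𝓝 τ :=
        Ioo_mem_nhds (lt_of_le_of_ne hτm.1 hne1.symm) (lt_of_le_of_ne hτm.2 hne2)
      rw [hasDerivAt_iff_isLittleO, Asymptotics.isLittleO_iff]
      intro ε hε
      set N := ε / (M + 4 * L) with hN
      have hN0 : 0 < N := by positivity
      have hNe : (M + 4 * L) * N = ε := by simp only [hN]; field_simp
      have hev := hρ.eventually (gt_mem_nhds hN0)
      rw [eventually_nhdsWithin_iff, Metric.eventually_nhds_iff] at hev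
      obtain ⟨q, hq, Hq⟩ := hev
      have hq' : 0 < q / (2 * L + 1) := by positivity
      filter_upwards [hτI, Metric.ball_mem_nhds τ hq'] with t ht htq
      have hqL : (2 * L + 1) * |t - τ| < q := by
        rw [Metric.mem_ball, Real.dist_eq, lt_div_iff₀ (by positivity)] at htq
        linarith
      -- All points used in the estimate lie near the boundary point at time `τ`.
      have hsmall : ∀ s₁ s₂, s₁ ∈ Icc (σ - δ) (σ + δ) → s₂ ∈ Icc (σ - δ) (σ + δ) →
          s₂ - s₁ = |t - τ| → τ ∈ Icc s₁ s₂ → ∀ τ' ∈ Icc s₁ s₂, ∀ y, (y, τ') ∈ domain a b →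
          y ≤ a s₁ + L * (s₂ - s₁) → ρ (y, τ') ≤ N := by
        intro s₁ s₂ hs₁ hs₂ hd hτs τ' hτ' y hy hyle
        refine (Hq ?_ hy).le
        have hτ'm : τ' ∈ Icc (σ - δ) (σ + δ) := ⟨hs₁.1.trans hτ'.1, hτ'.2.trans hs₂.2⟩
        have e1 := abs_le.1 (hLip τ' hτ'm τ hτm)
        have e2 := abs_le.1 (hLip s₁ hs₁ τ hτm)
        have e3 : |τ' - τ| ≤ |t - τ| := by
          rw [abs_le]; constructor <;> linarith [hτ'.1, hτ'.2, hτs.1, hτs.2]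
        have e4 : |s₁ - τ| ≤ |t - τ| := by
          rw [abs_le]; constructor <;> linarith [hτs.1, hτs.2, abs_nonneg (t - τ)]
        have e5 : (K : ℝ) * |τ' - τ| ≤ K * |t - τ| := mul_le_mul_of_nonneg_left e3 K.2
        have e6 : (K : ℝ) * |s₁ - τ| ≤ K * |t - τ| := mul_le_mul_of_nonneg_left e4 K.2
        have e7 : a τ' < y := hy.1
        have e8 : (2 * L + 1) * |t - τ| = 2 * (K * |t - τ|) + 3 * |t - τ| := by
          rw [hL]; ring
        have e9 : L * (s₂ - s₁) = K * |t - τ| + |t - τ| := by rw [hd, hL]; ring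
        have e10 := abs_nonneg (t - τ)
        have e11 : 0 ≤ (K : ℝ) * |t - τ| := mul_nonneg K.2 e10
        rw [Prod.dist_eq, max_lt_iff, Real.dist_eq, Real.dist_eq, abs_lt]
        exact ⟨⟨by simp only; linarith, by simp only; linarith⟩, by simp only; linarith⟩
      have ht' := Ioo_subset_Icc_self ht
      rw [smul_zero, sub_zero, Real.norm_eq_abs, Real.norm_eq_abs, ← hNe]
      rcases lt_trichotomy t τ with hlt | heq | hlt
      · have e : τ - t = |t - τ| := by rw [abs_of_neg (by linarith)]; ring
        rw [abs_sub_comm, ← e]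
        exact herr t ht' τ hτm hlt N (hsmall t τ ht' hτm e ⟨hlt.le, le_rfl⟩)
      · simp [heq]
      · have e : t - τ = |t - τ| := (abs_of_pos (by linarith)).symm
        rw [← e]
        exact herr τ hτm t ht' hlt N (hsmall τ t hτm ht' e ⟨le_rfl, hlt.le⟩)
    obtain ⟨C, hC⟩ := hLipG.absolutelyContinuousOnInterval.const_of_ae_hasDerivAt_zero (by
      have hne : ∀ x : ℝ, ∀ᵐ τ : ℝ, τ ≠ x := fun x => by
        simp [ae_iff, measure_singleton]
      filter_upwards [hzero, hne (σ - δ), hne (σ + δ)] with τ h1 h2 h3 h4 using h1 h4 h2 h3)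
    refine (hasDerivAt_const σ C).congr_of_eventuallyEq ?_
    filter_upwards [Icc_mem_nhds (show σ - δ < σ by linarith) (show σ < σ + δ by linarith)]
      with τ hτ
    exact hC τ (by rwa [uIcc_of_le (by linarith)])
  have := isOpen_Iio.is_const_of_deriv_eq_zero isPreconnected_Iio
    (fun σ hσ => (hloc σ hσ).differentiableAt.differentiableWithinAt)
    (fun σ hσ => (hloc σ hσ).deriv) (mem_Iio.2 ht) (mem_Iio.2 ht₀)
  simpa [hG] using this

lemma Flow.left_sub_le (h : Flow κ a b ρ u c) {p : ℝ}
    (hp : ∀ t, DifferentiableAt ℝ a t → deriv a t ≤ p) {s t : ℝ} (hst : s < t) :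
    a t - a s ≤ p * (t - s) := by
  obtain ⟨r, hr, hd⟩ := exists_mem_Ioo_of_ae (ae_differentiableAt_of_convexOn h.convex_left)
    (show s - 1 < s by linarith)
  have hd' : DifferentiableAt ℝ a r := by simpa using hd.fun_neg
  have h1 := h.convex_left.deriv_le_slope (mem_univ r) (mem_univ s) hr.2 hd
  have h2 := h.convex_left.slope_mono_adjacent (mem_univ r) (mem_univ t) hr.2 hst
  rw [show deriv (fun t => -a t) r = -deriv a r from deriv.neg, slope_def_field] at h1
  have h3 := hp r hd'
  have h4 : -p ≤ (-a t - -a s) / (t - s) := by linarith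
  rw [le_div_iff₀ (by linarith)] at h4
  linarith

/-- A 2-characteristic that comes from `t = -∞` carries a Riemann invariant not larger than the
velocity of the left boundary at `t = -∞`. The flux `ρ c` through the characteristic is integrable
because mass is finite, so the sound speed is negligible on the long run, and a larger invariant
would put the characteristic beyond the left boundary in the far past. -/
theorem Flow.riemann_le_of_eternal (h : Flow κ a b ρ u c) {p : ℝ}
    (hp : ∀ t, DifferentiableAt ℝ a t → deriv a t ≤ p) {X : ℝ → ℝ} {T t₀ : ℝ}
    (hX : IsCurve (domain a b) (fun z => u z + c z) (Iio T) X) (ht₀ : t₀ < T) :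
    u (X t₀, t₀) + c (X t₀, t₀) / κ ≤ p := by
  have hκ := h.kappa_pos
  by_contra! hcon
  set W := u (X t₀, t₀) + c (X t₀, t₀) / κ with hW
  set k := |1 / κ - 1| with hk
  have hk0 : 0 ≤ k := abs_nonneg _
  set η := (W - p) / 2 with hη
  have hη0 : 0 < η := by simp only [hη]; linarith
  set ε := η / (k + 1) with hε
  have hε0 : 0 < ε := by positivity
  have hkε : k * ε ≤ η := by
    have : (k + 1) * ε = η := by simp only [hε]; field_simp
    linarith
  obtain ⟨δ, hδ, hcmp⟩ := h.compare ε hε0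
  have hflux := h.continuousOn_flux hX
  set C := ∫ y in a t₀..X t₀, ρ (y, t₀) with hC
  have hfl : ∀ t < t₀, ∫ r in t..t₀, ρ (X r, r) * c (X r, r) ≤ C := by
    intro t ht
    have h1 := h.mass_balance hX ht₀ (ht.trans ht₀)
    have hm := (hX t (ht.trans ht₀)).1
    have h2 : 0 ≤ ∫ y in a t..X t, ρ (y, t) := by
      rw [intervalIntegral.integral_of_le hm.1.le]
      exact setIntegral_nonneg measurableSet_Ioc fun y hy =>
        (h.density_pos (y, t) ⟨hy.1, hy.2.trans_lt hm.2⟩).le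
    linarith
  have hmain : ∀ t < t₀, (W - η) * (t₀ - t) ≤ X t₀ - X t + k / δ * C := by
    intro t ht
    set Ψ : ℝ → ℝ := fun s => X s - k / δ * ∫ r in s..t₀, ρ (X r, r) * c (X r, r) with hΨ
    have hd : ∀ s ∈ Icc t t₀, HasDerivAt Ψ
        (u (X s, s) + c (X s, s) + k / δ * (ρ (X s, s) * c (X s, s))) s := by
      intro s hs
      have hsT : s < T := lt_of_le_of_lt hs.2 ht₀
      have h2 : HasDerivAt (fun τ => ∫ r in τ..t₀, ρ (X r, r) * c (X r, r))
          (-(ρ (X s, s) * c (X s, s))) s := by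
        refine intervalIntegral.integral_hasDerivAt_left ?_ ?_ ?_
        · refine (hflux.mono fun r hr => ?_).intervalIntegrable
          exact lt_of_le_of_lt hr.2 (max_lt hsT ht₀)
        · exact hflux.stronglyMeasurableAtFilter isOpen_Iio _ hsT
        · exact hflux.continuousAt (isOpen_Iio.mem_nhds hsT)
      exact ((hX s hsT).2.sub (h2.const_mul (k / δ))).congr_deriv (by ring)
    have hlow : (W - η) * (t₀ - t) ≤ Ψ t₀ - Ψ t := by
      refine (convex_Icc t t₀).mul_sub_le_image_sub_of_le_deriv
        (fun s hs => (hd s hs).continuousAt.continuousWithinAt)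
        (fun s hs => (hd s (interior_subset hs)).differentiableAt.differentiableWithinAt)
        (fun s hs => ?_) t (left_mem_Icc.2 ht.le) t₀ (right_mem_Icc.2 ht.le) ht.le
      have hs' := interior_subset hs
      have hsT : s < T := lt_of_le_of_lt hs'.2 ht₀
      have hm := (hX s hsT).1
      rw [(hd s hs').deriv]
      have e1 := h.riemann_two ordConnected_Iio hX (mem_Iio.2 hsT) (mem_Iio.2 ht₀)
      have e2 := h.sound_pos _ hm
      have e3 := h.density_pos _ hm
      have e4 : (1 / κ - 1) * c (X s, s) ≤ k * c (X s, s) :=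
        mul_le_mul_of_nonneg_right (le_abs_self _) e2.le
      have e5 : (1 / κ - 1) * c (X s, s) = c (X s, s) / κ - c (X s, s) := by ring
      have e6 : c (X s, s) ≤ ε + ρ (X s, s) * c (X s, s) / δ := by
        rcases le_or_gt (c (X s, s)) ε with hle | hgt
        · have : 0 ≤ ρ (X s, s) * c (X s, s) / δ := by positivity
          linarith
        · have := hcmp _ hm hgt
          have : c (X s, s) ≤ ρ (X s, s) * c (X s, s) / δ := by
            rw [le_div_iff₀ hδ, mul_comm]
            exact mul_le_mul_of_nonneg_right this e2.le
          linarith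
      have e7 := mul_le_mul_of_nonneg_left e6 hk0
      have e8 : k * (ε + ρ (X s, s) * c (X s, s) / δ)
          = k * ε + k / δ * (ρ (X s, s) * c (X s, s)) := by ring
      linarith
    have hkδ : 0 ≤ k / δ := by positivity
    have h3 := mul_le_mul_of_nonneg_left (hfl t ht) hkδ
    simp only [hΨ, intervalIntegral.integral_same] at hlow
    linarith
  -- Choose a time so far in the past that the two linear bounds contradict each other.
  set D := (X t₀ - a t₀ + k / δ * C) / η with hD
  have hDη : η * D = X t₀ - a t₀ + k / δ * C := by simp only [hD]; field_simp
  set t := t₀ - (|D| + 1) with ht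
  have htt : t < t₀ := by simp only [ht]; linarith [abs_nonneg D]
  have h1 := hmain t htt
  have h2 := h.left_sub_le hp htt
  have h3 : a t < X t := (hX t (htt.trans ht₀)).1.1
  have h4 : t₀ - t = |D| + 1 := by simp only [ht]; ring
  have h5 : W - η = p + η := by simp only [hη]; ring
  rw [h5] at h1
  have h6 : η * D < η * (t₀ - t) := by
    rw [h4]
    exact mul_lt_mul_of_pos_left (by linarith [le_abs_self D]) hη0
  have h7 : (p + η) * (t₀ - t) = p * (t₀ - t) + η * (t₀ - t) := by ring
  linarith

/-! ### No compressive fan at a boundary point -/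

/-- The balance law on which Lax's Riccati equation for `∂ₓ(u + c / κ)` rests: a suitable power of
the sound speed is transported by the 2-characteristics, with a source that has the sign of
`∂ₓ(u + c / κ)`. -/
lemma Flow.sound_power_law (h : Flow κ a b ρ u c) {z : ℝ × ℝ} (hz : z ∈ domain a b) :
    fderiv ℝ (fun z => c z ^ ((1 - κ) / (2 * κ))) z (0, 1)
      + fderiv ℝ (fun z => (u z + c z) * c z ^ ((1 - κ) / (2 * κ))) z (1, 0)
      = (1 + κ) / 2 * c z ^ ((1 - κ) / (2 * κ))
        * (fderiv ℝ u z (1, 0) + fderiv ℝ c z (1, 0) / κ) := by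
  have hκ := h.kappa_pos
  have hc := h.sound_pos z hz
  have h1 := (h.differentiableAt h.smooth_velocity hz).hasFDerivAt
  have h2 := (h.differentiableAt h.smooth_sound hz).hasFDerivAt
  have h3 := h2.rpow_const (p := (1 - κ) / (2 * κ)) (Or.inl hc.ne')
  rw [h3.fderiv, ((h1.fun_add h2).fun_mul h3).fderiv, Real.rpow_sub_one hc.ne']
  have e := h.eq_sound z hz
  simp only [_root_.add_apply, _root_.smul_apply, smul_eq_mul]
  generalize c z ^ ((1 - κ) / (2 * κ)) = P
  field_simp
  linear_combination (P - κ * P) * e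

lemma Flow.hasDerivAt_riemann_slice (h : Flow κ a b ρ u c) {x t : ℝ} (hx : (x, t) ∈ domain a b) :
    HasDerivAt (fun y => u (y, t) + c (y, t) / κ)
      (fderiv ℝ u (x, t) (1, 0) + fderiv ℝ c (x, t) (1, 0) / κ) x :=
  (hasDerivAt_slice (h.differentiableAt h.smooth_velocity hx)).add
    ((hasDerivAt_slice (h.differentiableAt h.smooth_sound hx)).div_const κ)

/-- A 2-characteristic that starts to the left of another one can be followed forwards at least
as long as that one. -/
lemma Flow.exists_forward_below (h : Flow κ a b ρ u c) {Y : ℝ → ℝ} {s τ x : ℝ}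
    (hY : IsCurve (domain a b) (fun z => u z + c z) (Icc s τ) Y) (hx : (x, s) ∈ domain a b)
    (hxY : x ≤ Y s) :
    ∃ Z : ℝ → ℝ, Z s = x ∧ IsCurve (domain a b) (fun z => u z + c z) (Icc s τ) Z := by
  obtain ⟨Z, T, hT, hZs, hZ | ⟨f, hf, hZ, hcont, hend⟩⟩ := h.exists_forward_two hx
  · exact ⟨Z, hZs, hZ.mono fun r hr => lt_of_lt_of_le hT hr.1⟩
  · rcases lt_or_ge τ f with hτf | hfτ
    · exact ⟨Z, hZs, hZ.mono fun r hr => ⟨lt_of_lt_of_le hT hr.1, lt_of_le_of_lt hr.2 hτf⟩⟩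
    · exfalso
      have hle : ∀ r ∈ Ico s f, Z r ≤ Y r := fun r hr =>
        IsCurve.le h.isOpen h.smooth_two ordConnected_Ico
          (hZ.mono fun q hq => ⟨lt_of_lt_of_le hT hq.1, hq.2⟩)
          (hY.mono fun q hq => ⟨hq.1, hq.2.le.trans hfτ⟩) (left_mem_Ico.2 hf) (by rwa [hZs]) hr
      have hYf := hY f ⟨hf.le, hfτ⟩
      have hlim : Z f ≤ Y f := by
        refine le_of_tendsto_of_tendsto (b := 𝓝[<] f) ((hcont f ⟨hT.trans hf, le_rfl⟩).mono_left ?_)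
          (hYf.2.continuousAt.tendsto.mono_left nhdsWithin_le_nhds) ?_
        · rw [← nhdsWithin_Ioo_eq_nhdsLT (hT.trans hf)]
          exact nhdsWithin_mono _ Ioo_subset_Ioc_self
        · filter_upwards [Ioo_mem_nhdsLT hf] with r hr using hle r ⟨hr.1.le, hr.2⟩
      have : Y f < b f := hYf.1.2
      linarith

/-- The 2-characteristic through `(x, t)` comes from the point of the left boundary at time `e`. -/
def EmittedAt (a b : ℝ → ℝ) (u c : ℝ × ℝ → ℝ) (e x t : ℝ) : Prop :=
  e < t ∧ ∃ Y : ℝ → ℝ, Y t = x ∧ IsCurve (domain a b) (fun z => u z + c z) (Ioc e t) Y ∧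
    ContinuousOn Y (Icc e t) ∧ Y e = a e

lemma nhdsGT_le_Icc {e t : ℝ} (h : e < t) : 𝓝[>] e ≤ 𝓝[Icc e t] e := by
  rw [← nhdsWithin_Ioo_eq_nhdsGT h]
  exact nhdsWithin_mono _ Ioo_subset_Icc_self

/-- Behind a 2-characteristic emitted from the left boundary the invariant `u - c / κ` is smaller
than the value of `u + c / κ` on it: the 1-characteristic through such a point must have crossed
it, since it cannot have come from the left boundary. -/
lemma Flow.riemann_one_lt (h : Flow κ a b ρ u c) {Y : ℝ → ℝ} {t₀ τ W s x : ℝ}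
    (hY : IsCurve (domain a b) (fun z => u z + c z) (Ioc t₀ τ) Y)
    (hYc : ContinuousOn Y (Icc t₀ τ)) (hY0 : Y t₀ = a t₀)
    (hW : ∀ r ∈ Ioc t₀ τ, u (Y r, r) + c (Y r, r) / κ = W) (hs : s ∈ Ioc t₀ τ)
    (hx : (x, s) ∈ domain a b) (hxY : x < Y s) : u (x, s) - c (x, s) / κ < W := by
  obtain ⟨Z, T, hT, hZs, hZ⟩ := h.exists_backward_one hx
  -- `e` is the last time down to which both curves can be followed.
  obtain ⟨e, het, het₀, hZc, hZcont, hZe⟩ : ∃ e < s, t₀ ≤ e ∧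
      IsCurve (domain a b) (fun z => u z - c z) (Ioc e s) Z ∧ ContinuousOn Z (Icc e s) ∧
      Y e < Z e := by
    rcases hZ with hZ | ⟨e, hes, hZ, hZcont, hend⟩
    · refine ⟨t₀, hs.1, le_rfl, hZ.mono fun r hr => lt_of_le_of_lt hr.2 hT,
        hZ.continuousOn.mono fun r hr => lt_of_le_of_lt hr.2 hT, ?_⟩
      rw [hY0]
      exact (hZ t₀ (hs.1.trans hT)).1.1
    · rcases lt_or_ge e t₀ with het | het
      · refine ⟨t₀, hs.1, le_rfl, hZ.mono fun r hr =>
          ⟨het.trans hr.1, lt_of_le_of_lt hr.2 hT⟩, hZcont.mono fun r hr =>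
          ⟨(het.trans_le hr.1).le, lt_of_le_of_lt hr.2 hT⟩, ?_⟩
        rw [hY0]
        exact (hZ t₀ ⟨het, hs.1.trans hT⟩).1.1
      · refine ⟨e, hes, het, hZ.mono fun r hr => ⟨hr.1, lt_of_le_of_lt hr.2 hT⟩,
          hZcont.mono fun r hr => ⟨hr.1, lt_of_le_of_lt hr.2 hT⟩, ?_⟩
        rw [hend]
        rcases het.eq_or_lt with rfl | hlt
        · rw [hY0]
          exact h.nonempty _
        · exact (hY e ⟨hlt, hes.le.trans hs.2⟩).1.2
  have hsub : Icc e s ⊆ Icc t₀ τ := Icc_subset_Icc het₀ hs.2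
  obtain ⟨r, hr, hcross⟩ : ∃ r ∈ Icc e s, Z r = Y r :=
    isPreconnected_Icc.intermediate_value₂ (right_mem_Icc.2 het.le) (left_mem_Icc.2 het.le)
      hZcont (hYc.mono hsub) (by rw [hZs]; exact hxY.le) hZe.le
  have hre : e < r := lt_of_le_of_ne hr.1 (by rintro rfl; exact hZe.ne' hcross)
  have e1 := h.riemann_one ordConnected_Ioc hZc (right_mem_Ioc.2 het) ⟨hre, hr.2⟩
  have hrτ : r ∈ Ioc t₀ τ := ⟨lt_of_le_of_lt het₀ hre, hr.2.trans hs.2⟩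
  have e2 := hW r hrτ
  have e3 : 0 < c (Y r, r) / κ := div_pos (h.sound_pos _ (hY r hrτ).1) h.kappa_pos
  rw [hZs, hcross] at e1
  linarith

lemma nonpos_of_antitoneOn {f : ℝ → ℝ} {p q x d : ℝ} (hf : AntitoneOn f (Icc p q))
    (hx : x ∈ Ioo p q) (hd : HasDerivAt f d x) : d ≤ 0 := by
  have h1 := hf.derivWithin_nonpos (x := x)
  rwa [derivWithin_of_mem_nhds (Icc_mem_nhds hx.1 hx.2), hd.deriv] at h1

/-- The 2-characteristics that leave one point of the left boundary cannot carry decreasing values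
of the Riemann invariant: the integral of a power of the sound speed over the fan would not
increase in time, although it starts from zero. -/
theorem Flow.not_compressive_fan (h : Flow κ a b ρ u c) {t₀ τ y₁ y₂ : ℝ} (hy : y₁ < y₂)
    (hem : ∀ y ∈ Icc y₁ y₂, EmittedAt a b u c t₀ y τ)
    (hanti : StrictAntiOn (fun y => u (y, τ) + c (y, τ) / κ) (Icc y₁ y₂)) : False := by
  have hκ := h.kappa_pos
  have hU := h.isOpen
  have hw := h.smooth_two
  set yₘ := (y₁ + y₂) / 2 with hyₘ
  have hm1 : y₁ < yₘ := by simp only [hyₘ]; linarith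
  have hm2 : yₘ < y₂ := by simp only [hyₘ]; linarith
  obtain ⟨hτ, Y₁, hY₁τ, hY₁, hY₁c, hY₁0⟩ := hem y₁ (left_mem_Icc.2 hy.le)
  obtain ⟨-, Yₘ, hYₘτ, hYₘ, hYₘc, hYₘ0⟩ := hem yₘ ⟨hm1.le, hm2.le⟩
  obtain ⟨-, Y₂, hY₂τ, hY₂, hY₂c, hY₂0⟩ := hem y₂ (right_mem_Icc.2 hy.le)
  have hτmem : τ ∈ Ioc t₀ τ := right_mem_Ioc.2 hτ
  have hlt1 : ∀ s ∈ Ioc t₀ τ, Y₁ s < Yₘ s := fun s hs =>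
    hY₁.lt hU hw ordConnected_Ioc hYₘ hτmem (by rwa [hY₁τ, hYₘτ]) hs
  have hlt2 : ∀ s ∈ Ioc t₀ τ, Yₘ s < Y₂ s := fun s hs =>
    hYₘ.lt hU hw ordConnected_Ioc hY₂ hτmem (by rwa [hYₘτ, hY₂τ]) hs
  -- Any point between two of the curves is carried to a point between their ends.
  have hcarry : ∀ s ∈ Ioc t₀ τ, ∀ x ∈ Icc (Y₁ s) (Y₂ s), ∃ Z : ℝ → ℝ, Z s = x ∧
      IsCurve (domain a b) (fun z => u z + c z) (Icc s τ) Z := by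
    intro s hs x hx
    refine h.exists_forward_below (hY₂.mono fun r hr => ⟨hs.1.trans_le hr.1, hr.2⟩) ?_ hx.2
    exact segment_mem_domain (hY₁ s hs).1 (hY₂ s hs).1 (Icc_subset_uIcc hx)
  have hIccIoc : ∀ s ∈ Ioc t₀ τ, Icc s τ ⊆ Ioc t₀ τ := fun s hs r hr =>
    ⟨hs.1.trans_le hr.1, hr.2⟩
  have hcle : ∀ s ∈ Ioc t₀ τ, ∀ Z Z' : ℝ → ℝ,
      IsCurve (domain a b) (fun z => u z + c z) (Icc s τ) Z →
      IsCurve (domain a b) (fun z => u z + c z) (Icc s τ) Z' → Z s ≤ Z' s → Z τ ≤ Z' τ :=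
    fun s hs Z Z' hZ hZ' hle => hZ.le hU hw ordConnected_Icc hZ' (left_mem_Icc.2 hs.2) hle
      (right_mem_Icc.2 hs.2)
  have hslice : ∀ s ∈ Ioc t₀ τ, AntitoneOn (fun y => u (y, s) + c (y, s) / κ)
      (Icc (Y₁ s) (Y₂ s)) := by
    intro s hs x hx x' hx' hxx'
    obtain ⟨Z, hZs, hZ⟩ := hcarry s hs x hx
    obtain ⟨Z', hZ's, hZ'⟩ := hcarry s hs x' hx'
    have e1 := h.riemann_two ordConnected_Icc hZ (left_mem_Icc.2 hs.2) (right_mem_Icc.2 hs.2)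
    have e2 := h.riemann_two ordConnected_Icc hZ' (left_mem_Icc.2 hs.2) (right_mem_Icc.2 hs.2)
    have hY₁' := hY₁.mono (hIccIoc s hs)
    have hY₂' := hY₂.mono (hIccIoc s hs)
    have i1 := hcle s hs _ _ hY₁' hZ (by rw [hZs]; exact hx.1)
    have i2 := hcle s hs _ _ hZ hZ' (by rw [hZs, hZ's]; exact hxx')
    have i3 := hcle s hs _ _ hZ' hY₂' (by rw [hZ's]; exact hx'.2)
    rw [hY₁τ] at i1
    rw [hY₂τ] at i3
    have := hanti.antitoneOn ⟨i1, i2.trans i3⟩ ⟨i1.trans i2, i3⟩ i2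
    rw [hZs] at e1
    rw [hZ's] at e2
    simp only at this ⊢
    linarith
  set W := u (y₂, τ) + c (y₂, τ) / κ with hW
  set V := u (yₘ, τ) + c (yₘ, τ) / κ with hV
  have hWV : W < V := hanti ⟨hm1.le, hm2.le⟩ (right_mem_Icc.2 hy.le) hm2
  have hWY : ∀ r ∈ Ioc t₀ τ, u (Y₂ r, r) + c (Y₂ r, r) / κ = W := fun r hr => by
    rw [h.riemann_two ordConnected_Ioc hY₂ hτmem hr, hY₂τ]
  have hVY : ∀ r ∈ Ioc t₀ τ, u (Yₘ r, r) + c (Yₘ r, r) / κ = V := fun r hr => by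
    rw [h.riemann_two ordConnected_Ioc hYₘ hτmem hr, hYₘτ]
  -- In the left half of the fan the sound speed is bounded away from zero.
  set c₀ := κ / 2 * (V - W) with hc₀
  have hc₀0 : 0 < c₀ := mul_pos (by positivity) (by linarith)
  have hmem : ∀ s ∈ Ioc t₀ τ, ∀ x ∈ Icc (Y₁ s) (Yₘ s), (x, s) ∈ domain a b := fun s hs x hx =>
    segment_mem_domain (hY₁ s hs).1 (hYₘ s hs).1 (Icc_subset_uIcc hx)
  have hclow : ∀ s ∈ Ioc t₀ τ, ∀ x ∈ Icc (Y₁ s) (Yₘ s), c₀ ≤ c (x, s) := by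
    intro s hs x hx
    have e1 := h.riemann_one_lt hY₂ hY₂c hY₂0 hWY hs (hmem s hs x hx)
      (lt_of_le_of_lt hx.2 (hlt2 s hs))
    have e2 := hslice s hs ⟨hx.1, hx.2.trans (hlt2 s hs).le⟩
      ⟨(hlt1 s hs).le, (hlt2 s hs).le⟩ hx.2
    simp only [hVY s hs] at e2
    have e3 : V - W ≤ 2 / κ * c (x, s) := by
      have : 2 / κ * c (x, s) = c (x, s) / κ + c (x, s) / κ := by ring
      linarith
    calc c₀ ≤ κ / 2 * (2 / κ * c (x, s)) := mul_le_mul_of_nonneg_left e3 (by positivity)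
      _ = c (x, s) := by field_simp
  obtain ⟨M, hM0, hM⟩ := h.exists_speed_bound
  set μ := (1 - κ) / (2 * κ) with hμ
  obtain ⟨C, hC⟩ : ∃ C, ∀ s ∈ Ioc t₀ τ, ∀ x ∈ Icc (Y₁ s) (Yₘ s), c (x, s) ^ μ ≤ C := by
    have hcont : ContinuousOn (fun r : ℝ => r ^ μ) (Icc c₀ M) := fun r hr =>
      (Real.continuousAt_rpow_const r μ (Or.inl (hc₀0.trans_le hr.1).ne')).continuousWithinAt
    obtain ⟨C, hC⟩ := isCompact_Icc.exists_bound_of_continuousOn hcont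
    exact ⟨C, fun s hs x hx => (le_abs_self _).trans
      (hC _ ⟨hclow s hs x hx, (hM _ (hmem s hs x hx)).2.2.1⟩)⟩
  have hsm : ContDiffOn ℝ 1 (fun z => c z ^ μ) (domain a b) :=
    h.smooth_sound.rpow_const_of_ne fun z hz => (h.sound_pos z hz).ne'
  set N : ℝ → ℝ := fun s => ∫ x in Y₁ s..Yₘ s, c (x, s) ^ μ with hN
  have hNint : ∀ s ∈ Ioc t₀ τ, IntervalIntegrable (fun x => c (x, s) ^ μ) volume (Y₁ s) (Yₘ s) :=
    fun s hs => (continuousOn_slice hsm.continuousOn (hY₁ s hs).1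
      (hYₘ s hs).1).intervalIntegrable
  have hNd : ∀ s ∈ Ioc t₀ τ, ∃ d ≤ 0, HasDerivAt N d s := by
    intro s hs
    have hder := hasDerivAt_integral_between hU hsm (hw.mul hsm)
      (fun z hz => h.sound_power_law hz) (hY₁ s hs).1 (hYₘ s hs).1 (hY₁ s hs).2 (hYₘ s hs).2
    refine ⟨_, ?_, hder⟩
    simp only
    have hneg : ∫ x in Y₁ s..Yₘ s, (1 + κ) / 2 * c (x, s) ^ μ
        * (fderiv ℝ u (x, s) (1, 0) + fderiv ℝ c (x, s) (1, 0) / κ) ≤ 0 := by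
      rw [intervalIntegral.integral_of_le (hlt1 s hs).le]
      refine setIntegral_nonpos measurableSet_Ioc fun x hx => ?_
      have hm := hmem s hs x (Ioc_subset_Icc_self hx)
      refine mul_nonpos_of_nonneg_of_nonpos ?_ ?_
      · exact mul_nonneg (by linarith) (Real.rpow_nonneg (h.sound_pos _ hm).le _)
      · exact nonpos_of_antitoneOn (hslice s hs) ⟨hx.1, hx.2.trans_lt (hlt2 s hs)⟩
          (h.hasDerivAt_riemann_slice hm)
    linarith
  have hNanti : AntitoneOn N (Ioc t₀ τ) := by
    refine antitoneOn_of_deriv_nonpos (convex_Ioc _ _) (fun s hs => ?_) (fun s hs => ?_)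
      (fun s hs => ?_)
    · obtain ⟨d, -, hd⟩ := hNd s hs
      exact hd.continuousAt.continuousWithinAt
    · obtain ⟨d, -, hd⟩ := hNd s (interior_subset hs)
      exact hd.differentiableAt.differentiableWithinAt
    · obtain ⟨d, hd0, hd⟩ := hNd s (interior_subset hs)
      rwa [hd.deriv]
  have hNpos : 0 < N τ := by
    refine intervalIntegral.intervalIntegral_pos_of_pos_on (hNint τ hτmem) (fun x hx => ?_)
      (hlt1 τ hτmem)
    exact Real.rpow_pos_of_pos (h.sound_pos _ (hmem τ hτmem x (Ioo_subset_Icc_self hx))) _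
  have hNle : ∀ s ∈ Ioc t₀ τ, N τ ≤ C * (Yₘ s - Y₁ s) := by
    intro s hs
    refine (hNanti hs hτmem hs.2).trans ?_
    calc N s ≤ ∫ _ in Y₁ s..Yₘ s, C :=
          intervalIntegral.integral_mono_on (hlt1 s hs).le (hNint s hs) intervalIntegrable_const
            (hC s hs)
      _ = C * (Yₘ s - Y₁ s) := by rw [intervalIntegral.integral_const, smul_eq_mul, mul_comm]
  have hlim : Tendsto (fun s => C * (Yₘ s - Y₁ s)) (𝓝[>] t₀) (𝓝 (C * (Yₘ t₀ - Y₁ t₀))) :=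
    (((hYₘc t₀ (left_mem_Icc.2 hτ.le)).mono_left (nhdsGT_le_Icc hτ)).sub
      ((hY₁c t₀ (left_mem_Icc.2 hτ.le)).mono_left (nhdsGT_le_Icc hτ))).const_mul C
  have : N τ ≤ C * (Yₘ t₀ - Y₁ t₀) := by
    refine ge_of_tendsto hlim ?_
    filter_upwards [Ioc_mem_nhdsGT hτ] with s hs using hNle s hs
  rw [hYₘ0, hY₁0, sub_self, mul_zero] at this
  linarith

/-! ### Comparison of the velocities of the two boundaries -/

/-- Where the Riemann invariant exceeds all velocities of the left boundary, 2-characteristics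
come from that boundary. -/
lemma Flow.exists_emittedAt (h : Flow κ a b ρ u c) {p : ℝ}
    (hp : ∀ t, DifferentiableAt ℝ a t → deriv a t ≤ p) {x t : ℝ} (hx : (x, t) ∈ domain a b)
    (hpx : p < u (x, t) + c (x, t) / κ) : ∃ e, EmittedAt a b u c e x t := by
  obtain ⟨X, T, hT, hXt, hX | ⟨e, het, hX, hcont, hend⟩⟩ := h.exists_backward_two hx
  · have := h.riemann_le_of_eternal hp hX hT
    rw [hXt] at this
    linarith
  · exact ⟨e, het, X, hXt, hX.mono fun r hr => ⟨hr.1, lt_of_le_of_lt hr.2 hT⟩,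
      hcont.mono fun r hr => ⟨hr.1, lt_of_le_of_lt hr.2 hT⟩, hend⟩

/-- Where the Riemann invariant exceeds all velocities of the left boundary, all 2-characteristics
come from the same point of that boundary: at almost every time in between, the boundary would emit
2-characteristics that carry its own velocity. -/
lemma Flow.emission_time_eq (h : Flow κ a b ρ u c) {p q : ℝ} (hpq : p < q)
    (hp : ∀ t, DifferentiableAt ℝ a t → deriv a t ≤ p) {x₁ x₂ t e₁ e₂ : ℝ} (hx : x₁ ≤ x₂)
    (hq : ∀ x ∈ Icc x₁ x₂, q < u (x, t) + c (x, t) / κ)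
    (h₁ : EmittedAt a b u c e₁ x₁ t) (h₂ : EmittedAt a b u c e₂ x₂ t) : e₁ = e₂ := by
  have hU := h.isOpen
  have hw := h.smooth_two
  obtain ⟨he₁, X₁, hX₁t, hX₁, hX₁c, hX₁e⟩ := h₁
  obtain ⟨he₂, X₂, hX₂t, hX₂, hX₂c, hX₂e⟩ := h₂
  rcases lt_trichotomy e₁ e₂ with hlt | heq | hlt
  · exfalso
    have hle : ∀ r ∈ Ioc e₂ t, X₁ r ≤ X₂ r := fun r hr =>
      (hX₁.mono (Ioc_subset_Ioc_left hlt.le)).le hU hw ordConnected_Ioc hX₂ (right_mem_Ioc.2 he₂)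
        (by rwa [hX₁t, hX₂t]) hr
    have hlim : X₁ e₂ ≤ X₂ e₂ := by
      refine le_of_tendsto_of_tendsto (b := 𝓝[>] e₂)
        ((hX₁ e₂ ⟨hlt, he₂.le⟩).2.continuousAt.tendsto.mono_left nhdsWithin_le_nhds)
        ((hX₂c e₂ (left_mem_Icc.2 he₂.le)).mono_left (nhdsGT_le_Icc he₂)) ?_
      filter_upwards [Ioc_mem_nhdsGT he₂] with r hr using hle r hr
    have : a e₂ < X₁ e₂ := (hX₁ e₂ ⟨hlt, he₂.le⟩).1.1
    linarith
  · exact heq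
  · exfalso
    obtain ⟨s, hs, hds, -, hcs⟩ := exists_mem_Ioo_of_ae h.ae_good_left hlt
    have hst : s < t := hs.2.trans he₁
    have hev := h.eventually_le_deriv_add hds hcs (show 0 < q - p by linarith)
    have hX₂s := hX₂ s ⟨hs.1, hst.le⟩
    -- A point near the left boundary at time `s`, to the left of the second characteristic.
    have htend : Tendsto (fun x : ℝ => (x, s)) (𝓝[>] (a s)) (𝓝[domain a b] (a s, s)) := by
      refine tendsto_nhdsWithin_iff.2 ⟨?_, ?_⟩
      · exact (Continuous.prodMk_left s).continuousAt.tendsto.mono_left nhdsWithin_le_nhds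
      · filter_upwards [Ioo_mem_nhdsGT (h.nonempty s)] with x hx using hx
    obtain ⟨y, hy, hyI⟩ := ((htend.eventually hev).and (Ioo_mem_nhdsGT hX₂s.1.1)).exists
    have hym : (y, s) ∈ domain a b := ⟨hyI.1, hyI.2.trans hX₂s.1.2⟩
    obtain ⟨Z, hZs, hZ⟩ := h.exists_forward_below
      (hX₂.mono fun r hr => ⟨hs.1.trans_le hr.1, hr.2⟩) hym hyI.2.le
    have hZ2 : Z t ≤ x₂ := by
      rw [← hX₂t]
      exact hZ.le hU hw ordConnected_Icc (hX₂.mono fun r hr => ⟨hs.1.trans_le hr.1, hr.2⟩)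
        (left_mem_Icc.2 hst.le) (by rw [hZs]; exact hyI.2.le) (right_mem_Icc.2 hst.le)
    have hZ1 : x₁ ≤ Z t := by
      by_contra! hcon
      have hle : ∀ r ∈ Ioc e₁ t, Z r ≤ X₁ r := fun r hr =>
        (hZ.mono fun q hq => ⟨(hs.2.trans hq.1).le, hq.2⟩).le hU hw ordConnected_Ioc hX₁
          (right_mem_Ioc.2 he₁) (by rw [hX₁t]; exact hcon.le) hr
      have hZe := hZ e₁ ⟨hs.2.le, he₁.le⟩
      have hlim : Z e₁ ≤ X₁ e₁ := by
        refine le_of_tendsto_of_tendsto (b := 𝓝[>] e₁)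
          (hZe.2.continuousAt.tendsto.mono_left nhdsWithin_le_nhds)
          ((hX₁c e₁ (left_mem_Icc.2 he₁.le)).mono_left (nhdsGT_le_Icc he₁)) ?_
        filter_upwards [Ioc_mem_nhdsGT he₁] with r hr using hle r hr
      have : a e₁ < Z e₁ := hZe.1.1
      linarith
    have e1 := h.riemann_two ordConnected_Icc hZ (left_mem_Icc.2 hst.le) (right_mem_Icc.2 hst.le)
    rw [hZs] at e1
    have e2 := hq (Z t) ⟨hZ1, hZ2⟩
    have e3 := hp s hds
    linarith

/-- The velocity of the right boundary is bounded by any bound for the velocity of the left one. -/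
theorem Flow.deriv_right_le (h : Flow κ a b ρ u c) {p : ℝ}
    (hp : ∀ t, DifferentiableAt ℝ a t → deriv a t ≤ p) {t₁ : ℝ} (ht₁ : DifferentiableAt ℝ b t₁) :
    deriv b t₁ ≤ p := by
  by_contra! hcon
  have hU := h.isOpen
  obtain ⟨q, hpq, hqb⟩ := exists_between hcon
  obtain ⟨t, ht, hdt, -, hct⟩ := exists_mem_Ioo_of_ae h.ae_good_right
    (show t₁ < t₁ + 1 by linarith)
  have hbt : q < deriv b t :=
    hqb.trans_le (deriv_le_deriv_of_convexOn h.convex_right ht.1.le ht₁ hdt)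
  -- Near the right boundary at time `t` the invariant exceeds `q`.
  have hnear : ∃ x, (x, t) ∈ domain a b ∧ q < u (x, t) + c (x, t) / κ := by
    have hev := h.eventually_deriv_sub_le hdt hct (show 0 < (deriv b t - q) / 2 by linarith)
    have htend : Tendsto (fun x : ℝ => (x, t)) (𝓝[<] (b t)) (𝓝[domain a b] (b t, t)) := by
      refine tendsto_nhdsWithin_iff.2 ⟨?_, ?_⟩
      · exact (Continuous.prodMk_left t).continuousAt.tendsto.mono_left nhdsWithin_le_nhds
      · filter_upwards [Ioo_mem_nhdsLT (h.nonempty t)] with x hx using hx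
    obtain ⟨x, hx1, hx2⟩ := ((htend.eventually hev).and
      (Ioo_mem_nhdsLT (h.nonempty t))).exists
    have hm : (x, t) ∈ domain a b := hx2
    have : 0 < c (x, t) / κ := div_pos (h.sound_pos _ hm) h.kappa_pos
    exact ⟨x, hm, by linarith⟩
  obtain ⟨x, hx, hqx⟩ := hnear
  obtain ⟨t₀, ht₀, X, hXt, hX, hXc, hX0⟩ := h.exists_emittedAt hp hx (hpq.trans hqx)
  obtain ⟨M, hM0, hM⟩ := h.exists_speed_bound
  -- Shortly after the emission, what comes from the emission point cannot reach `b`.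
  obtain ⟨τ, hτ, hτb⟩ : ∃ τ ∈ Ioc t₀ t, a t₀ + M * (τ - t₀) < b τ := by
    have hc1 : ContinuousAt (fun τ => b τ - (a t₀ + M * (τ - t₀))) t₀ := by
      have := h.continuous_right
      fun_prop
    have hpos : 0 < b t₀ - (a t₀ + M * (t₀ - t₀)) := by
      have := h.nonempty t₀
      rw [sub_self, mul_zero]; linarith
    obtain ⟨τ, h1, h2⟩ := (((hc1.eventually (lt_mem_nhds hpos)).filter_mono
      (nhdsWithin_le_nhds (s := Ioi t₀))).and (Ioc_mem_nhdsGT ht₀)).exists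
    exact ⟨τ, h2, by linarith⟩
  have hXτ : EmittedAt a b u c t₀ (X τ) τ :=
    ⟨hτ.1, X, rfl, hX.mono (Ioc_subset_Ioc_right hτ.2), hXc.mono (Icc_subset_Icc_right hτ.2), hX0⟩
  have hqX : q < u (X τ, τ) + c (X τ, τ) / κ := by
    have := h.riemann_two ordConnected_Ioc hX hτ (right_mem_Ioc.2 ht₀)
    rw [hXt] at this
    linarith
  have hXm := (hX τ hτ).1
  have hXb : X τ < b τ := hXm.2
  have hmem : ∀ y, X τ ≤ y → y < b τ → (y, τ) ∈ domain a b := fun y h1 h2 =>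
    ⟨lt_of_lt_of_le hXm.1 h1, h2⟩
  set f : ℝ → ℝ := fun y => u (y, τ) + c (y, τ) / κ with hf
  have hemit : ∀ y, X τ ≤ y → y < b τ → (∀ x ∈ Icc (X τ) y, q < f x) →
      EmittedAt a b u c t₀ y τ := by
    intro y h1 h2 h3
    obtain ⟨e, he⟩ := h.exists_emittedAt hp (hmem y h1 h2) (hpq.trans (h3 y ⟨h1, le_rfl⟩))
    rwa [← h.emission_time_eq hpq hp h1 h3 hXτ he] at he
  -- Hence the invariant drops to `q` somewhere to the right of the characteristic `X`.
  obtain ⟨y₀, hy₀, hfy₀⟩ : ∃ y₀ ∈ Ico (X τ) (b τ), f y₀ ≤ q := by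
    by_contra! hall
    obtain ⟨y, hy1, hy2⟩ := exists_between (max_lt hXb hτb)
    have hXy : X τ ≤ y := (le_max_left _ _).trans hy1.le
    obtain ⟨-, Y, hYτ, hY, hYc, hY0⟩ := hemit y hXy hy2 fun x hx =>
      hall x ⟨hx.1, lt_of_le_of_lt hx.2 hy2⟩
    have hbound : ∀ r ∈ Ioc t₀ τ, y - Y r ≤ M * (τ - t₀) := by
      intro r hr
      have h1 := IsCurve.abs_sub_le (fun z hz => (hM z hz).2.2.2) ordConnected_Ioc hY hr
        (right_mem_Ioc.2 hτ.1)
      rw [hYτ, abs_of_nonneg (a := τ - r) (by linarith [hr.2])] at h1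
      refine (le_abs_self _).trans (h1.trans ?_)
      exact mul_le_mul_of_nonneg_left (by linarith [hr.1]) hM0.le
    have hlim : y - Y t₀ ≤ M * (τ - t₀) := by
      refine le_of_tendsto (f := fun r => y - Y r) (x := 𝓝[>] t₀) (tendsto_const_nhds.sub
        ((hYc t₀ (left_mem_Icc.2 hτ.1.le)).mono_left (nhdsGT_le_Icc hτ.1))) ?_
      filter_upwards [Ioc_mem_nhdsGT hτ.1] with r hr using hbound r hr
    have := le_max_right (X τ) (a t₀ + M * (τ - t₀))
    rw [hY0] at hlim
    linarith
  have hfd : ∀ y ∈ Ico (X τ) (b τ), HasDerivAt f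
      (fderiv ℝ u (y, τ) (1, 0) + fderiv ℝ c (y, τ) (1, 0) / κ) y := fun y hy =>
    h.hasDerivAt_riemann_slice (hmem y hy.1 hy.2)
  have hsub : Icc (X τ) y₀ ⊆ Ico (X τ) (b τ) := fun y hy => ⟨hy.1, lt_of_le_of_lt hy.2 hy₀.2⟩
  have hfc : ContinuousOn f (Icc (X τ) y₀) := fun y hy =>
    (hfd y (hsub hy)).continuousAt.continuousWithinAt
  set S := {y ∈ Icc (X τ) y₀ | f y ≤ q} with hS
  have hScl : IsClosed S := by
    have := hfc.preimage_isClosed_of_isClosed isClosed_Icc (isClosed_Iic (a := q))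
    exact this
  have hSne : S.Nonempty := ⟨y₀, ⟨hy₀.1, le_rfl⟩, hfy₀⟩
  have hSbd : BddBelow S := ⟨X τ, fun y hy => hy.1.1⟩
  set y' := sInf S with hy'
  have hy'S : y' ∈ S := hScl.csInf_mem hSne hSbd
  have hXy' : X τ < y' := lt_of_le_of_ne hy'S.1.1 fun heq => by
    have := hy'S.2
    rw [← heq] at this
    exact absurd this (not_le.2 hqX)
  have hbefore : ∀ y ∈ Ico (X τ) y', q < f y := by
    intro y hy
    by_contra! hle
    exact absurd (csInf_le hSbd ⟨⟨hy.1, hy.2.le.trans hy'S.1.2⟩, hle⟩) (not_le.2 hy.2)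
  have hsub' : Icc (X τ) y' ⊆ Icc (X τ) y₀ := Icc_subset_Icc_right hy'S.1.2
  obtain ⟨ξ, hξ, hslope⟩ := exists_hasDerivAt_eq_slope f
    (fun y => fderiv ℝ u (y, τ) (1, 0) + fderiv ℝ c (y, τ) (1, 0) / κ) hXy' (hfc.mono hsub')
    (fun y hy => hfd y (hsub (hsub' (Ioo_subset_Icc_self hy))))
  have hneg : fderiv ℝ u (ξ, τ) (1, 0) + fderiv ℝ c (ξ, τ) (1, 0) / κ < 0 := by
    rw [hslope]
    refine div_neg_of_neg_of_pos ?_ (by linarith)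
    have h1 := hy'S.2
    have h2 : q < f (X τ) := hqX
    linarith
  -- The invariant decreases near `ξ`, inside the fan.
  have hdc : ContinuousAt (fun y => fderiv ℝ u (y, τ) (1, 0) + fderiv ℝ c (y, τ) (1, 0) / κ) ξ := by
    have hm : (ξ, τ) ∈ domain a b :=
      hmem ξ hξ.1.le ((hsub (hsub' (Ioo_subset_Icc_self hξ))).2)
    have hmk : ContinuousAt (fun y : ℝ => (y, τ)) ξ := by fun_prop
    have hcu : ContinuousAt (fun z => fderiv ℝ u z (1, 0)) (ξ, τ) :=
      ((h.smooth_velocity.continuousOn_fderiv_of_isOpen hU le_rfl).clm_apply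
        continuousOn_const).continuousAt (hU.mem_nhds hm)
    have hcc : ContinuousAt (fun z => fderiv ℝ c z (1, 0)) (ξ, τ) :=
      ((h.smooth_sound.continuousOn_fderiv_of_isOpen hU le_rfl).clm_apply
        continuousOn_const).continuousAt (hU.mem_nhds hm)
    exact (ContinuousAt.comp (f := fun y : ℝ => (y, τ)) hcu hmk).add
      ((ContinuousAt.comp (f := fun y : ℝ => (y, τ)) hcc hmk).div_const κ)
  obtain ⟨r, hr, hball⟩ := Metric.eventually_nhds_iff.1
    ((hdc.eventually (gt_mem_nhds hneg)).and (Ioo_mem_nhds hξ.1 hξ.2))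
  have hnear : ∀ y ∈ Icc (ξ - r / 2) (ξ + r / 2),
      fderiv ℝ u (y, τ) (1, 0) + fderiv ℝ c (y, τ) (1, 0) / κ < 0 ∧ y ∈ Ioo (X τ) y' := by
    intro y hy
    refine hball ?_
    rw [Real.dist_eq, abs_lt]
    constructor <;> linarith [hy.1, hy.2]
  have hin : ∀ y ∈ Icc (ξ - r / 2) (ξ + r / 2), y ∈ Ico (X τ) (b τ) := fun y hy =>
    hsub (hsub' (Ioo_subset_Icc_self (hnear y hy).2))
  refine h.not_compressive_fan (t₀ := t₀) (τ := τ) (y₁ := ξ - r / 2) (y₂ := ξ + r / 2)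
    (by linarith) (fun y hy => ?_) ?_
  · exact hemit y (hin y hy).1 (hin y hy).2 fun x hx =>
      hbefore x ⟨hx.1, lt_of_le_of_lt hx.2 (hnear y hy).2.2⟩
  · refine strictAntiOn_of_deriv_neg (convex_Icc _ _)
      (fun y hy => (hfd y (hin y hy)).continuousAt.continuousWithinAt) fun y hy => ?_
    have hy := interior_subset hy
    rw [(hfd y (hin y hy)).deriv]
    exact (hnear y hy).1

/-! ### From the weak to the pointwise equations -/

lemma integrable_mul_of_tsupport_subset {U : Set (ℝ × ℝ)} {F ψ : ℝ × ℝ → ℝ}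
    (hF : ContinuousOn F U) (hψ : Continuous ψ) (hc : HasCompactSupport ψ) (hs : tsupport ψ ⊆ U) :
    Integrable (fun z => F z * ψ z) := by
  have hsupp : Function.support (fun z => F z * ψ z) ⊆ tsupport ψ := fun z hz =>
    subset_tsupport ψ (right_ne_zero_of_mul hz)
  rw [← integrableOn_iff_integrable_of_support_subset hsupp]
  exact ((hF.mono hs).mul hψ.continuousOn).integrableOn_compact hc

/-- A distributional conservation law between `C¹` functions holds pointwise. -/
theorem ConservedIn.pointwise {U : Set (ℝ × ℝ)} (hU : IsOpen U) {g f : ℝ × ℝ → ℝ}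
    (hg : ContDiffOn ℝ 1 g U) (hf : ContDiffOn ℝ 1 f U) (h : ConservedIn U g f) :
    ∀ z ∈ U, fderiv ℝ g z (0, 1) + fderiv ℝ f z (1, 0) = 0 := by
  have hd : ∀ k : ℝ × ℝ → ℝ, ContDiffOn ℝ 1 k U → ∀ v : ℝ × ℝ,
      ContinuousOn (fun z => fderiv ℝ k z v) U := fun k hk v =>
    (hk.continuousOn_fderiv_of_isOpen hU le_rfl).clm_apply continuousOn_const
  set H : ℝ × ℝ → ℝ := fun z => fderiv ℝ g z (0, 1) + fderiv ℝ f z (1, 0) with hH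
  have hHc : ContinuousOn H U := (hd g hg _).add (hd f hf _)
  have hae : ∀ᵐ z, z ∈ U → H z = 0 := by
    refine hU.ae_eq_zero_of_integral_contDiff_smul_eq_zero
      (hHc.locallyIntegrableOn hU.measurableSet) fun φ hφ hφc hφs => ?_
    have hφd : ∀ v : ℝ × ℝ, Continuous (fun z => fderiv ℝ φ z v) := fun v =>
      (hφ.continuous_fderiv (by simp)).clm_apply continuous_const
    have hφdc : ∀ v : ℝ × ℝ, HasCompactSupport (fun z => fderiv ℝ φ z v) := fun v =>
      hφc.fderiv_apply (𝕜 := ℝ) v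
    have hφds : ∀ v : ℝ × ℝ, tsupport (fun z => fderiv ℝ φ z v) ⊆ U := fun v =>
      (tsupport_fderiv_apply_subset ℝ v).trans hφs
    have hparts : ∀ k : ℝ × ℝ → ℝ, ContDiffOn ℝ 1 k U → ∀ v : ℝ × ℝ,
        ∫ z, k z * fderiv ℝ φ z v = -∫ z, fderiv ℝ k z v * φ z := fun k hk v =>
      integral_mul_fderiv_eq_neg_fderiv_mul_of_integrable
        (integrable_mul_of_tsupport_subset (hd k hk v) hφ.continuous hφc hφs)
        (integrable_mul_of_tsupport_subset hk.continuousOn (hφd v) (hφdc v) (hφds v))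
        (integrable_mul_of_tsupport_subset hk.continuousOn hφ.continuous hφc hφs)
        (fun z hz => (hk.contDiffAt (hU.mem_nhds (hφs hz))).differentiableAt one_ne_zero)
        (fun z _ => hφ.differentiable (by simp) z)
    have h0 := h φ ⟨hφ, hφc, hφs⟩
    rw [weakPairing, integral_add
      (integrable_mul_of_tsupport_subset hg.continuousOn (hφd _) (hφdc _) (hφds _))
      (integrable_mul_of_tsupport_subset hf.continuousOn (hφd _) (hφdc _) (hφds _)),
      hparts g hg, hparts f hf] at h0
    have hsplit : ∫ z, φ z • H z
        = (∫ z, fderiv ℝ g z (0, 1) * φ z) + ∫ z, fderiv ℝ f z (1, 0) * φ z := by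
      rw [← integral_add
        (integrable_mul_of_tsupport_subset (hd g hg _) hφ.continuous hφc hφs)
        (integrable_mul_of_tsupport_subset (hd f hf _) hφ.continuous hφc hφs)]
      refine integral_congr_ae (ae_of_all _ fun z => ?_)
      simp only [hH, smul_eq_mul]
      ring
    rw [hsplit]
    linarith
  intro z hz
  by_contra hne
  have hopen : IsOpen (U ∩ H ⁻¹' {0}ᶜ) := hHc.isOpen_inter_preimage hU isOpen_compl_singleton
  have hnull : volume (U ∩ H ⁻¹' {0}ᶜ) = 0 := by
    refine measure_mono_null (fun y hy => ?_) hae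
    exact fun hy' => hy.2 (hy' hy.1)
  have := hopen.eq_empty_of_measure_zero hnull
  exact (this ▸ (⟨hz, hne⟩ : z ∈ U ∩ H ⁻¹' {0}ᶜ) : z ∈ (∅ : Set (ℝ × ℝ)))

/-- A smooth admissible flow satisfies the reduced system for velocity and sound speed. -/
theorem IsAdmissible.flow {A γ : ℝ} (hA : 0 < A) (hγ : 1 < γ) (h : IsAdmissible A γ a b ρ u)
    (hρ : ContDiffOn ℝ 1 ρ (domain a b)) (hu : ContDiffOn ℝ 1 u (domain a b)) :
    Flow ((γ - 1) / 2) a b ρ u (fun z => soundSpeed A γ (ρ z)) := by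
  set κ := (γ - 1) / 2 with hκdef
  have hκ : 0 < κ := by simp only [hκdef]; linarith
  set K := √(γ * A) with hKdef
  have hK : 0 < K := Real.sqrt_pos.2 (by positivity)
  have hK2 : K * K = γ * A := Real.mul_self_sqrt (by positivity)
  have hcont_b : Continuous b := h.convex_right.locallyLipschitz.continuous
  have hcont_a : Continuous a := by
    simpa only [neg_neg] using h.convex_left.locallyLipschitz.continuous.fun_neg
  have hU : IsOpen (domain a b) := isOpen_domain hcont_a hcont_b
  have hpos : ∀ z ∈ domain a b, 0 < ρ z := fun z hz => (h.density_pos_iff z).2 hz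
  have hc : (fun z => soundSpeed A γ (ρ z)) = fun z => K * ρ z ^ κ := rfl
  have hpow : ∀ q : ℝ, ContDiffOn ℝ 1 (fun z => ρ z ^ q) (domain a b) := fun q =>
    hρ.rpow_const_of_ne fun z hz => (hpos z hz).ne'
  have hρd : ∀ z ∈ domain a b, HasFDerivAt ρ (fderiv ℝ ρ z) z := fun z hz =>
    ((hρ.contDiffAt (hU.mem_nhds hz)).differentiableAt one_ne_zero).hasFDerivAt
  have hud : ∀ z ∈ domain a b, HasFDerivAt u (fderiv ℝ u z) z := fun z hz =>
    ((hu.contDiffAt (hU.mem_nhds hz)).differentiableAt one_ne_zero).hasFDerivAt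
  have hcd : ∀ z ∈ domain a b, fderiv ℝ (fun z => K * ρ z ^ κ) z
      = K • (κ * (ρ z ^ κ / ρ z)) • fderiv ℝ ρ z := fun z hz => by
    have := ((hρd z hz).rpow_const (p := κ) (Or.inl (hpos z hz).ne')).const_mul K
    rw [this.fderiv, Real.rpow_sub_one (hpos z hz).ne']
  have hmass : ∀ z ∈ domain a b, fderiv ℝ ρ z (0, 1) + u z * fderiv ℝ ρ z (1, 0)
      + ρ z * fderiv ℝ u z (1, 0) = 0 := by
    intro z hz
    have e := h.mass.pointwise hU hρ (hρ.mul hu) z hz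
    rw [((hρd z hz).fun_mul (hud z hz)).fderiv] at e
    simp only [_root_.add_apply, _root_.smul_apply, smul_eq_mul] at e
    linarith
  have hcvac : ∀ {l : Filter (ℝ × ℝ)}, Tendsto ρ l (𝓝 0) →
      Tendsto (fun z => K * ρ z ^ κ) l (𝓝 0) := fun hl => by
    have h1 := ((Real.continuousAt_rpow_const 0 κ (Or.inr hκ.le)).tendsto.comp hl).const_mul K
    simpa [Real.zero_rpow hκ.ne'] using h1
  rw [hc]
  refine ⟨hκ, h.measurable_density, ?_, hpos, ?_, ?_, h.nonempty, h.convex_right, h.convex_left,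
    hρ, hu, contDiffOn_const.mul (hpow κ), hmass, ?_, ?_, ?_, ?_, h.char_two_right,
    h.char_two_left, h.char_one_right, h.char_one_left⟩
  · obtain ⟨M, hM⟩ := h.bounded
    refine ⟨max M (K * M ^ κ), fun z hz => ?_⟩
    obtain ⟨h1, h2⟩ := hM z hz
    refine ⟨h1.trans (le_max_left _ _), h2.trans (le_max_left _ _), le_trans ?_ (le_max_right _ _)⟩
    exact mul_le_mul_of_nonneg_left (Real.rpow_le_rpow (hpos z hz).le h1 hκ.le) hK.le
  · exact fun z hz => mul_pos hK (Real.rpow_pos_of_pos (hpos z hz) _)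
  · intro ε hε
    have hεK : 0 < ε / K := by positivity
    refine ⟨(ε / K) ^ κ⁻¹, Real.rpow_pos_of_pos hεK _, fun z hz hlt => ?_⟩
    by_contra! hcon
    have h1 : ρ z ^ κ < ε / K := by
      have := Real.rpow_lt_rpow (hpos z hz).le hcon hκ
      rwa [Real.rpow_inv_rpow hεK.le hκ.ne'] at this
    rw [lt_div_iff₀ hK] at h1
    linarith
  · intro z hz
    have e := h.momentum.pointwise hU (hρ.mul hu) ((hρ.mul (hu.pow 2)).add
      (contDiffOn_const.mul (hpow γ))) z hz
    have hpd := ((hρd z hz).rpow_const (p := γ) (Or.inl (hpos z hz).ne')).const_mul A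
    have hpd' := ((hρd z hz).fun_mul ((hud z hz).pow 2)).fun_add hpd
    rw [hpd'.fderiv, ((hρd z hz).fun_mul (hud z hz)).fderiv] at e
    have hm := hmass z hz
    have hP : ρ z ^ (γ - 1) = ρ z ^ κ * ρ z ^ κ := by
      rw [← Real.rpow_add (hpos z hz)]
      congr 1
      simp only [hκdef]; ring
    have hρ0 := (hpos z hz).ne'
    rw [hcd z hz]
    simp only [_root_.add_apply, _root_.smul_apply, smul_eq_mul, nsmul_eq_mul, hP] at e ⊢
    generalize ρ z ^ κ = P at e ⊢
    have hκ0 := hκ.ne'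
    clear_value κ
    field_simp
    push_cast at e
    simp only [pow_one] at e
    linear_combination e - u z * hm + P ^ 2 * fderiv ℝ ρ z (1, 0) * hK2
  · intro z hz
    have hm := hmass z hz
    have hρ0 := (hpos z hz).ne'
    rw [hcd z hz]
    simp only [_root_.smul_apply, smul_eq_mul]
    generalize ρ z ^ κ = P
    clear_value κ
    field_simp
    linear_combination K * κ * P * hm
  · filter_upwards [h.vacuum_right] with t ht using ⟨ht, hcvac ht⟩
  · filter_upwards [h.vacuum_left] with t ht using ⟨ht, hcvac ht⟩

/-! ### Limits of the boundary velocities -/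

/-- The values of the derivative of `f` at the points where it exists. -/
def slopes (f : ℝ → ℝ) : Set ℝ := deriv f '' {t | DifferentiableAt ℝ f t}

lemma slopes_nonempty {f : ℝ → ℝ} (hf : ConvexOn ℝ univ f) : (slopes f).Nonempty := by
  obtain ⟨t, -, ht⟩ := exists_mem_Ioo_of_ae (ae_differentiableAt_of_convexOn hf) one_pos
  exact ⟨_, t, ht, rfl⟩

lemma derivTendsto_atTop {f : ℝ → ℝ} (hf : ConvexOn ℝ univ f) {v : ℝ} (hv : IsLUB (slopes f) v) :
    DerivTendsto f atTop v := by
  refine ⟨?_, ?_⟩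
  · rw [← frequently_mem_iff_neBot, frequently_atTop]
    intro t
    obtain ⟨s, hs, hd⟩ := exists_mem_Ioo_of_ae (ae_differentiableAt_of_convexOn hf)
      (show t < t + 1 by linarith)
    exact ⟨s, hs.1.le, hd⟩
  · rw [tendsto_order]
    refine ⟨fun r hr => ?_, fun r hr => ?_⟩
    · obtain ⟨_, ⟨t, ht, rfl⟩, hlt, -⟩ := hv.exists_between hr
      rw [eventually_inf_principal]
      filter_upwards [eventually_ge_atTop t] with s hs hd
      exact hlt.trans_le (deriv_le_deriv_of_convexOn hf hs ht hd)
    · rw [eventually_inf_principal]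
      exact Eventually.of_forall fun s hd => (hv.1 ⟨s, hd, rfl⟩).trans_lt hr

lemma derivTendsto_atBot {f : ℝ → ℝ} (hf : ConvexOn ℝ univ f) {v : ℝ} (hv : IsGLB (slopes f) v) :
    DerivTendsto f atBot v := by
  refine ⟨?_, ?_⟩
  · rw [← frequently_mem_iff_neBot, frequently_atBot]
    intro t
    obtain ⟨s, hs, hd⟩ := exists_mem_Ioo_of_ae (ae_differentiableAt_of_convexOn hf)
      (show t - 1 < t by linarith)
    exact ⟨s, hs.2.le, hd⟩
  · rw [tendsto_order]
    refine ⟨fun r hr => ?_, fun r hr => ?_⟩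
    · rw [eventually_inf_principal]
      exact Eventually.of_forall fun s hd => hr.trans_le (hv.1 ⟨s, hd, rfl⟩)
    · obtain ⟨_, ⟨t, ht, rfl⟩, -, hlt⟩ := hv.exists_between hr
      rw [eventually_inf_principal]
      filter_upwards [eventually_le_atBot t] with s hs hd
      exact (deriv_le_deriv_of_convexOn hf hs hd ht).trans_lt hlt

lemma DerivTendsto.of_neg {f : ℝ → ℝ} {l : Filter ℝ} {v : ℝ}
    (h : DerivTendsto (fun t => -f t) l (-v)) : DerivTendsto f l v := by
  have hset : {t | DifferentiableAt ℝ (fun t => -f t) t} = {t | DifferentiableAt ℝ f t} := by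
    ext t; simp
  have hderiv : deriv (fun t => -f t) = fun t => -deriv f t := by
    ext t; exact deriv.fun_neg
  rw [DerivTendsto, hset, hderiv] at h
  exact ⟨h.1, by simpa using h.2.neg⟩

lemma forall_deriv_reflect {σ : ℝ} (hσ : σ * σ = 1) {f : ℝ → ℝ} {k p : ℝ} :
    (∀ t, DifferentiableAt ℝ (fun t => -f (σ * t)) t → k * deriv (fun t => -f (σ * t)) t ≤ p) ↔
      ∀ t, DifferentiableAt ℝ f t → k * (-σ * deriv f t) ≤ p := by
  have hs : ∀ s : ℝ, σ * (σ * s) = s := fun s => by rw [← mul_assoc, hσ, one_mul]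
  have hd : ∀ t, deriv (fun t => -f (σ * t)) t = -σ * deriv f (σ * t) := fun t => by
    rw [deriv.fun_neg, deriv_comp_mul_left, smul_eq_mul, neg_mul]
  have hdiff : ∀ (g : ℝ → ℝ) t, DifferentiableAt ℝ g (σ * t) →
      DifferentiableAt ℝ (fun t => -g (σ * t)) t := fun g t hg =>
    (DifferentiableAt.comp (f := fun t => σ * t) t hg (by fun_prop)).fun_neg
  constructor
  · intro H t ht
    have := H (σ * t) (hdiff f _ (by rwa [hs]))
    rwa [hd, hs] at this
  · intro H t ht
    rw [hd]
    refine H _ ?_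
    have := hdiff (fun t => -f (σ * t)) (σ * t) (by rwa [hs])
    simpa [hs] using this

/-- `Flow.deriv_right_le` for the reflected flows. -/
lemma Flow.deriv_left_le (h : Flow κ a b ρ u c) {σ p : ℝ} (hσ : σ * σ = 1)
    (hp : ∀ t, DifferentiableAt ℝ b t → -σ * deriv b t ≤ p) {t : ℝ} (ht : DifferentiableAt ℝ a t) :
    -σ * deriv a t ≤ p := by
  have h1 := (forall_deriv_reflect (k := 1) hσ).2 (by simpa only [one_mul] using hp)
  have h2 := (forall_deriv_reflect (k := 1) (p := p) (f := a) hσ).1 fun t ht => by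
    rw [one_mul]
    exact (h.reflect hσ).deriv_right_le (by simpa only [one_mul] using h1) ht
  simpa only [one_mul] using h2 t ht

/-- The velocities of the two boundaries have the same upper bounds and the same lower bounds. -/
theorem Flow.bounds_slopes (h : Flow κ a b ρ u c) :
    upperBounds (slopes a) = upperBounds (slopes b) ∧
      lowerBounds (slopes a) = lowerBounds (slopes b) := by
  have hm : (-1 : ℝ) * -1 = 1 := by norm_num
  have hone : (1 : ℝ) * 1 = 1 := by norm_num
  refine ⟨Subset.antisymm ?_ ?_, Subset.antisymm ?_ ?_⟩
  · rintro p hp _ ⟨t, ht, rfl⟩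
    exact h.deriv_right_le (fun s hs => hp ⟨s, hs, rfl⟩) ht
  · rintro p hp _ ⟨t, ht, rfl⟩
    have := h.deriv_left_le hm (p := p) (fun s hs => by
      rw [neg_neg, one_mul]; exact hp ⟨s, hs, rfl⟩) ht
    linarith
  · rintro p hp _ ⟨t, ht, rfl⟩
    -- The reflection `(x, t) ↦ (-x, -t)` exchanges the roles of the boundaries once more.
    have key := (forall_deriv_reflect (k := -1) (f := b) (p := -p) hm).1 fun s hs =>
      (h.reflect hm).deriv_left_le hone ((forall_deriv_reflect (k := -1) hm).2 fun s hs => by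
        have : p ≤ deriv a s := hp ⟨s, hs, rfl⟩
        linarith) hs
    have := key t ht
    linarith
  · rintro p hp _ ⟨t, ht, rfl⟩
    have := h.deriv_left_le hone (p := -p) (fun s hs => by
      have : p ≤ deriv b s := hp ⟨s, hs, rfl⟩
      linarith) ht
    linarith

lemma Flow.bddAbove_slopes (h : Flow κ a b ρ u c) : BddAbove (slopes b) := by
  obtain ⟨M, hM⟩ := h.exists_deriv_right_le
  refine ⟨M, ?_⟩
  rintro _ ⟨t, ht, rfl⟩
  exact hM t ht

lemma Flow.bddBelow_slopes (h : Flow κ a b ρ u c) : BddBelow (slopes b) := by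
  have hm : (-1 : ℝ) * -1 = 1 := by norm_num
  have hone : (1 : ℝ) * 1 = 1 := by norm_num
  -- The composition of the two reflections reverses time.
  obtain ⟨M, hM⟩ := ((h.reflect hm).reflect hone).exists_deriv_right_le
  have h1 := (forall_deriv_reflect (k := 1) (p := M) hone).1 (by simpa only [one_mul] using hM)
  have h2 := (forall_deriv_reflect (k := -1) (p := M) (f := b) hm).1 fun t ht => by
    have := h1 t ht
    linarith
  refine ⟨-M, ?_⟩
  rintro _ ⟨t, ht, rfl⟩
  have := h2 t ht
  linarith

lemma slopes_neg (f : ℝ → ℝ) : slopes (fun t => -f t) = -slopes f := by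
  ext v
  simp only [slopes, mem_image, mem_ofPred_eq, Set.mem_neg, differentiableAt_fun_neg_iff,
    deriv.fun_neg]
  refine exists_congr fun t => and_congr_right fun _ => ?_
  rw [neg_eq_iff_eq_neg]

end GasFlow

end

theorem mainTheorem2 (A γ : ℝ) (hA : 0 < A) (hγ : 1 < γ) (a b : ℝ → ℝ) (ρ u : ℝ × ℝ → ℝ)
    (hadm : GasFlow.IsAdmissible A γ a b ρ u)
    (hρ : ContDiffOn ℝ 2 ρ (GasFlow.domain a b))
    (hu : ContDiffOn ℝ 2 u (GasFlow.domain a b)) :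
    ∃ pPlus pMinus qPlus qMinus : ℝ,
      GasFlow.DerivTendsto a atTop pPlus ∧ GasFlow.DerivTendsto a atBot pMinus ∧
      GasFlow.DerivTendsto b atTop qPlus ∧ GasFlow.DerivTendsto b atBot qMinus ∧
      pPlus = qMinus ∧ pMinus = qPlus := by
  have h := hadm.flow hA hγ (hρ.of_le one_le_two) (hu.of_le one_le_two)
  have hne := GasFlow.slopes_nonempty h.convex_right
  have hlub := isLUB_csSup hne h.bddAbove_slopes
  have hglb := isGLB_csInf hne h.bddBelow_slopes
  have hlub' : IsLUB (GasFlow.slopes a) (sSup (GasFlow.slopes b)) := by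
    rwa [IsLUB, h.bounds_slopes.1]
  have hglb' : IsGLB (GasFlow.slopes a) (sInf (GasFlow.slopes b)) := by
    rwa [IsGLB, h.bounds_slopes.2]
  refine ⟨sInf (GasFlow.slopes b), sSup (GasFlow.slopes b), sSup (GasFlow.slopes b),
    sInf (GasFlow.slopes b), ?_, ?_, GasFlow.derivTendsto_atTop h.convex_right hlub,
    GasFlow.derivTendsto_atBot h.convex_right hglb, rfl, rfl⟩
  -- The left boundary is concave, so its velocity decreases from its supremum to its infimum.
  · refine (GasFlow.derivTendsto_atTop h.convex_left ?_).of_neg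
    rw [GasFlow.slopes_neg]
    exact hglb'.neg
  · refine (GasFlow.derivTendsto_atBot h.convex_left ?_).of_neg
    rw [GasFlow.slopes_neg]
    exact hlub'.neg
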